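/- All matroids here may have infinite ground sets. For a division ring $R$ and a matrix $A\in R^{X\times Y}$ (with $X,Y$ arbitrary sets), the vector matroid of $A$ is the matroid with ground set $Y$ in which $I\subseteq Y$ is independent iff the columns of $A$ indexed by $I$ are linearly independent over $R$. A matroid is regular if it is the vector matroid of a totally unimodular matrix over $\mathbb{Q}$, i.e. of a matrix all of whose finite square submatrices have determinant in $\{0,1,-1\}$. If $X$ and $Y$ are disjoint sets and $B\in\mathbb{Z}_2^{X\times Y}$, then $B$ is called a standard $\mathbb{Z}_2$ representation of the vector matroid of $[\,1\mid B\,]\in\mathbb{Z}_2^{X\times(X\cup Y)}$. Let $B_\ell\in\mathbb{Z}_2^{X_\ell\times Y_\ell}$ and $B_r\in\mathbb{Z}_2^{X_r\times Y_r}$, where $X_\ell\cap Y_\ell=X_r\cap Y_r=X_\ell\cap Y_r=Y_\ell\cap X_r=\emptyset$, $X_\ell\cap X_r=\{x_2,x_1,x_0\}$ with $x_0,x_1,x_2$ distinct, and $Y_\ell\cap Y_r=\{y_0,y_1,y_2\}$ with $y_0,y_1,y_2$ distinct. Suppose that - $B_\ell(x_2,y_0)=B_\ell(x_2,y_1)=1$,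 $B_\ell(x_1,y_2)=B_\ell(x_0,y_2)=1$, and $B_\ell(i,y_2)=0$ for all $i\in X_\ell\setminus\{x_1,x_0\}$; - $B_r(x_2,y_0)=B_r(x_2,y_1)=1$, $B_r(x_1,y_2)=B_r(x_0,y_2)=1$, and $B_r(x_2,j)=0$ for all $j\in Y_r\setminus\{y_0,y_1\}$; - the submatrices of $B_\ell$ and $B_r$ on $\{x_1,x_0\}\times\{y_0,y_1\}$ are the same matrix $D_0$, and $D_0$ is invertible. Put $A_\ell=B_\ell(X_\ell\setminus\{x_1,x_0\},\,Y_\ell\setminus\{y_2\})$, $A_r=B_r(X_r\setminus\{x_2\},\,Y_r\setminus\{y_0,y_1\})$, $D_\ell=B_\ell(\{x_1,x_0\},\,Y_\ell\setminus\{y_0,y_1,y_2\})$, $D_r=B_r(X_r\setminus\{x_2,x_1,x_0\},\,\{y_0,y_1\})$. The $3$-sum $B_\ell\oplus_3 B_r\in\mathbb{Z}_2^{(X_\ell\cup X_r)\times(Y_\ell\cup Y_r)}$ is $$B=\begin{bmatrix}A_\ell & 0\\ D & A_r\end{bmatrix},\qquad D=\begin{bmatrix}D_\ell & D_0\\ D_rD_0^{-1}D_\ell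 & D_r\end{bmatrix},$$ where the row blocks of $B$ are indexed by $X_\ell\setminus\{x_1,x_0\}$ and $X_r\setminus\{x_2\}$, its column blocks by $Y_\ell\setminus\{y_2\}$ and $Y_r\setminus\{y_0,y_1\}$, the row blocks of $D$ by $\{x_1,x_0\}$ and $X_r\setminus\{x_2,x_1,x_0\}$, and its column blocks by $Y_\ell\setminus\{y_0,y_1,y_2\}$ and $\{y_0,y_1\}$. A matroid $M$ is a $3$-sum of matroids $M_\ell$ and $M_r$ if there are such $B_\ell$, $B_r$ and $B=B_\ell\oplus_3B_r$ which are standard $\mathbb{Z}_2$ representations of $M_\ell$, $M_r$ and $M$, respectively. **Theorem.** Let $M$ be a $3$-sum of regular matroids $M_\ell$ and $M_r$. Then $M$ is also regular. -/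

import Mathlib

open Set

/-- Augmentation for linear independence of a (possibly infinite) family of vectors. -/
theorem linearIndepOn_augment {R V ι : Type*} [DivisionRing R] [AddCommGroup V] [Module R V]
    {f : ι → V} {I J B : Set ι} (hI : LinearIndepOn R f I) (hJ : LinearIndepOn R f J)
    (hIJ : I ⊂ J) (hB : Maximal (fun K : Set ι => LinearIndepOn R f K) B) :
    ∃ x ∈ B \ I, LinearIndepOn R f (insert x I) := by
  by_contra! h
  obtain ⟨e, heJ, heI⟩ := exists_of_ssubset hIJ
  have hBI : f '' B ⊆ Submodule.span R (f '' I) := by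
    rintro _ ⟨x, hx, rfl⟩
    by_cases hxI : x ∈ I
    · exact Submodule.subset_span (mem_image_of_mem f hxI)
    · by_contra hxs
      exact h x ⟨hx, hxI⟩ (hI.insert hxs)
  have heB : f e ∈ Submodule.span R (f '' B) := by
    rw [hB.prop.mem_span_iff]
    intro hins
    exact hB.le_of_ge hins (subset_insert e B) (mem_insert e B)
  have hins : LinearIndepOn R f (insert e I) := hJ.mono (insert_subset heJ hIJ.subset)
  exact ((linearIndepOn_insert heI).mp hins).2 (Submodule.span_le.mpr hBI heB)

/-- The vector matroid of a matrix `A` whose columns are indexed by a set `Y`: its ground set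
is `Y`, and a set `I ⊆ Y` is independent iff the columns of `A` indexed by `I` are linearly
independent. No finiteness is required. -/
def Matrix.vectorMatroid {α ρ R : Type*} [DivisionRing R] {Y : Set α} (A : Matrix ρ Y R) :
    Matroid α :=
  (IndepMatroid.ofFinitary
    (E := Y)
    (Indep := fun I => I ⊆ Y ∧ LinearIndepOn R A.col ((fun j : Y => (j : α)) ⁻¹' I))
    (indep_empty := by simp)
    (indep_subset := fun _ _ hJ hIJ => ⟨hIJ.trans hJ.1, hJ.2.mono (preimage_mono hIJ)⟩)
    (indep_aug := by
      rintro I B ⟨hIY, hI⟩ hImax hB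
      obtain ⟨J, hIJ, hJ⟩ : ∃ J, I ⊂ J ∧ J ⊆ Y ∧
          LinearIndepOn R A.col ((fun j : Y => (j : α)) ⁻¹' J) := by
        by_contra! h
        refine hImax ⟨⟨hIY, hI⟩, fun J hJ hIJ => ?_⟩
        by_contra hJI
        exact h J ⟨hIJ, hJI⟩ hJ.1 hJ.2
      have hpre : ∀ {K L : Set α}, K ⊆ Y →
          (fun j : Y => (j : α)) ⁻¹' K ⊆ (fun j : Y => (j : α)) ⁻¹' L → K ⊆ L :=
        fun hK hKL x hx => hKL (a := ⟨x, hK hx⟩) hx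
      obtain ⟨x, hx, hxI⟩ := linearIndepOn_augment hI hJ.2
        ⟨preimage_mono hIJ.subset, fun h => hIJ.2 (hpre hJ.1 h)⟩
        (B := (fun j : Y => (j : α)) ⁻¹' B) ⟨hB.prop.2, fun K hK hBK => by
          have hle := hB.le_of_ge (y := Subtype.val '' K)
            ⟨Subtype.coe_image_subset Y K, by
              simpa [preimage_image_eq K Subtype.val_injective] using hK⟩
            (hpre (hB.prop.1) (by
              simpa [preimage_image_eq K Subtype.val_injective] using hBK))
          exact fun y hy => hle (mem_image_of_mem _ hy)⟩
      refine ⟨x, hx, insert_subset x.2 hIY, hxI.mono ?_⟩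
      rintro y (hy | hy)
      · exact Or.inl (Subtype.ext hy)
      · exact Or.inr hy)
    (indep_compact := by
      refine fun I hI => ⟨fun x hx => (hI {x} (by simpa) (finite_singleton x)).1 rfl,
        linearIndepOn_of_finite _ fun t ht htfin => ?_⟩
      have := (hI (Subtype.val '' t) (by rintro _ ⟨y, hy, rfl⟩; exact ht hy)
        (htfin.image _)).2
      simpa [preimage_image_eq t Subtype.val_injective] using this)
    (subset_ground := fun _ h => h.1)).matroid

@[simp] theorem Matrix.vectorMatroid_E {α ρ R : Type*} [DivisionRing R] {Y : Set α}
    (A : Matrix ρ Y R) : A.vectorMatroid.E = Y := rfl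

theorem Matrix.vectorMatroid_indep_iff {α ρ R : Type*} [DivisionRing R] {Y : Set α}
    (A : Matrix ρ Y R) (I : Set α) :
    A.vectorMatroid.Indep I ↔
      I ⊆ Y ∧ LinearIndepOn R A.col ((fun j : Y => (j : α)) ⁻¹' I) := Iff.rfl

/-- A matroid is regular if it is the vector matroid of a totally unimodular rational matrix. -/
def Matroid.IsRegular.{u} {α : Type u} (M : Matroid α) : Prop :=
  ∃ (X : Type u) (Y : Set α) (A : Matrix X Y ℚ), A.IsTotallyUnimodular ∧ A.vectorMatroid = M

/-- The data of a standard representation: a matrix `B` over `R` whose rows and columns are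
indexed by disjoint sets `X` and `Y`. -/
structure StandardRepr (α R : Type*) where
  /-- the row index set -/
  X : Set α
  /-- the column index set -/
  Y : Set α
  /-- row and column indices are disjoint -/
  disjoint : Disjoint X Y
  /-- the matrix -/
  B : Matrix X Y R

namespace StandardRepr

open scoped Classical in
/-- The matrix `[1 | B]`, with rows indexed by `X` and columns indexed by `X ∪ Y`. -/
noncomputable def toFull {α R : Type*} [DivisionRing R] (S : StandardRepr α R) :
    Matrix S.X (S.X ∪ S.Y : Set α) R :=
  (Matrix.fromCols (1 : Matrix S.X S.X R) S.B).submatrix id (Equiv.Set.union S.disjoint)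

/-- The matroid of which `S` is a standard representation. -/
noncomputable def toMatroid {α R : Type*} [DivisionRing R] (S : StandardRepr α R) : Matroid α :=
  S.toFull.vectorMatroid

open scoped Classical in
/-- The entry `B(i, j)` for `i ∈ X` and `j ∈ Y` (and `0` for other indices). -/
noncomputable def entry {α R : Type*} [DivisionRing R] (S : StandardRepr α R) (i j : α) : R :=
  if h : i ∈ S.X ∧ j ∈ S.Y then S.B ⟨i, h.1⟩ ⟨j, h.2⟩ else 0

/-- `S = Sₗ ⊕₃ Sᵣ`, where `Sₗ` and `Sᵣ` have the block form required for a `3`-sum with respect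
to the shared rows `x₂, x₁, x₀` and the shared columns `y₀, y₁, y₂`:
```
        Yₗ∖Y'   y₀ y₁ | y₂                    y₀ y₁ | y₂  Yᵣ∖Y'
Xₗ∖X'           Aₗ    | 0              x₂     1  1  | 0    0
x₂              1  1  | 0              x₁       D₀  | 1   Aᵣ
x₁       Dₗ      D₀   | 1              x₀           | 1
x₀                    | 1              Xᵣ∖X'    Dᵣ  |
```
with `X' = {x₂, x₁, x₀}` and `Y' = {y₀, y₁, y₂}`. Here `Aₗ` is the block of `Sₗ` on rows
`Xₗ ∖ {x₁, x₀}` and columns `Yₗ ∖ {y₂}`, and `Aᵣ` is the block of `Sᵣ` on rows `Xᵣ ∖ {x₂}` and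
columns `Yᵣ ∖ {y₀, y₁}`. -/
structure IsSum3 {α : Type*} (S Sₗ Sᵣ : StandardRepr α (ZMod 2)) (x₀ x₁ x₂ y₀ y₁ y₂ : α)
    (D₀ : Matrix (Fin 2) (Fin 2) (ZMod 2)) : Prop where
  -- the index sets
  x₀_ne_x₁ : x₀ ≠ x₁
  x₀_ne_x₂ : x₀ ≠ x₂
  x₁_ne_x₂ : x₁ ≠ x₂
  y₀_ne_y₁ : y₀ ≠ y₁
  y₀_ne_y₂ : y₀ ≠ y₂
  y₁_ne_y₂ : y₁ ≠ y₂
  inter_X : Sₗ.X ∩ Sᵣ.X = {x₂, x₁, x₀}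
  inter_Y : Sₗ.Y ∩ Sᵣ.Y = {y₀, y₁, y₂}
  disjoint_Xₗ_Yᵣ : Disjoint Sₗ.X Sᵣ.Y
  disjoint_Yₗ_Xᵣ : Disjoint Sₗ.Y Sᵣ.X
  -- the block `D₀`, with rows `x₁, x₀` and columns `y₀, y₁`
  isUnit_D₀ : IsUnit D₀
  D₀_left : !![Sₗ.entry x₁ y₀, Sₗ.entry x₁ y₁; Sₗ.entry x₀ y₀, Sₗ.entry x₀ y₁] = D₀
  D₀_right : !![Sᵣ.entry x₁ y₀, Sᵣ.entry x₁ y₁; Sᵣ.entry x₀ y₀, Sᵣ.entry x₀ y₁] = D₀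
  -- the prescribed entries of `Sₗ`
  left_x₂_y₀ : Sₗ.entry x₂ y₀ = 1
  left_x₂_y₁ : Sₗ.entry x₂ y₁ = 1
  left_x₁_y₂ : Sₗ.entry x₁ y₂ = 1
  left_x₀_y₂ : Sₗ.entry x₀ y₂ = 1
  left_zero : ∀ i ∈ Sₗ.X \ {x₁, x₀}, Sₗ.entry i y₂ = 0
  -- the prescribed entries of `Sᵣ`
  right_x₂_y₀ : Sᵣ.entry x₂ y₀ = 1
  right_x₂_y₁ : Sᵣ.entry x₂ y₁ = 1
  right_x₁_y₂ : Sᵣ.entry x₁ y₂ = 1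
  right_x₀_y₂ : Sᵣ.entry x₀ y₂ = 1
  right_zero : ∀ j ∈ Sᵣ.Y \ {y₀, y₁}, Sᵣ.entry x₂ j = 0
  -- the index sets of the sum
  X_eq : S.X = Sₗ.X ∪ Sᵣ.X
  Y_eq : S.Y = Sₗ.Y ∪ Sᵣ.Y
  -- block `Aₗ`
  sum_Aₗ : ∀ i ∈ Sₗ.X \ {x₁, x₀}, ∀ j ∈ Sₗ.Y \ {y₂}, S.entry i j = Sₗ.entry i j
  -- block `0`
  sum_zero : ∀ i ∈ Sₗ.X \ {x₁, x₀}, ∀ j ∈ Sᵣ.Y \ {y₀, y₁}, S.entry i j = 0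
  -- block `Aᵣ`
  sum_Aᵣ : ∀ i ∈ Sᵣ.X \ {x₂}, ∀ j ∈ Sᵣ.Y \ {y₀, y₁}, S.entry i j = Sᵣ.entry i j
  -- block `D₀`
  sum_D₀ : !![S.entry x₁ y₀, S.entry x₁ y₁; S.entry x₀ y₀, S.entry x₀ y₁] = D₀
  -- block `Dₗ`
  sum_Dₗ : ∀ i ∈ ({x₁, x₀} : Set α), ∀ j ∈ Sₗ.Y \ {y₀, y₁, y₂}, S.entry i j = Sₗ.entry i j
  -- block `Dᵣ`
  sum_Dᵣ : ∀ i ∈ Sᵣ.X \ {x₂, x₁, x₀}, ∀ j ∈ ({y₀, y₁} : Set α), S.entry i j = Sᵣ.entry i j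
  -- block `Dₗᵣ = Dᵣ * D₀⁻¹ * Dₗ`
  sum_Dₗᵣ : ∀ i ∈ Sᵣ.X \ {x₂, x₁, x₀}, ∀ j ∈ Sₗ.Y \ {y₀, y₁, y₂},
    S.entry i j =
      ![Sᵣ.entry i y₀, Sᵣ.entry i y₁] ⬝ᵥ (D₀⁻¹.mulVec ![Sₗ.entry x₁ j, Sₗ.entry x₀ j])

end StandardRepr

/-- `M` is a `3`-sum of `Mₗ` and `Mᵣ` if these matroids have standard representations over `ℤ₂`
of which the first is the `3`-sum of the other two. -/
def Matroid.IsSum3of {α : Type*} (M Mₗ Mᵣ : Matroid α) : Prop :=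
  ∃ S Sₗ Sᵣ : StandardRepr α (ZMod 2),
    (∃ (x₀ x₁ x₂ y₀ y₁ y₂ : α) (D₀ : Matrix (Fin 2) (Fin 2) (ZMod 2)),
      S.IsSum3 Sₗ Sᵣ x₀ x₁ x₂ y₀ y₁ y₂ D₀) ∧
    S.toMatroid = M ∧ Sₗ.toMatroid = Mₗ ∧ Sᵣ.toMatroid = Mᵣ

/-! A binary matroid is determined by its cycle space C, the finitely supported relations over `ZMod
2` between its columns. Regularity becomes a property of C alone (`IsUnimodularLift`): some lattice
Λ of integer vectors reduces modulo two into C, is closed under halving, and contains a lift with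
entries in {0, 1, -1} of every cycle. The integer relations of a totally unimodular matrix form such
a lattice (`Matrix.IsTotallyUnimodular.isUnimodularLift`). Conversely, writing the ground set modulo
Λ in terms of a base produces a totally unimodular matrix (`Matroid.IsRepresentedBy.isRegular`).
Since the binary cycle space is unique, the signs of the given matrices never have to be chosen
entry by entry.

In a 3-sum, {x₁, x₀, y₂} is a cycle of the left summand, and every cycle of the right summand meets
{x₂, y₀, y₁} evenly. A cycle of the sum is glued from a left cycle a and a right cycle b such that
the class of a on the triangle modulo (1, 1, 1) is D₀ applied to (b y₀, b y₁)
(`mem_cycles_of_compatible`, `exists_compatible`).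

The same gluing works over ℤ, with (1, 1, 1) replaced by a signed lift τ of the triangle and with a
sign γ relating the entries at y₀ and y₁ (`exists_sign`). The linking pairs of suitable {0, 1, -1}
lifts then lie in the set formed by the origin and the six vertices of a hexagon (`IsTriangular`).
There a point is known up to sign from its reduction modulo two, and D₀ has an integral lift
preserving this set. Hence the two sides agree after possibly negating a, and the glued lattice is a
unimodular lift for the sum. -/

/-! ### Binary cycle spaces and their unimodular lifts. -/

/-- A submodule of finitely supported vectors represents `M` if its supports lie in the ground set
and a subset of the ground set is dependent iff it contains the support of a nonzero member. -/
def Matroid.IsRepresentedBy {α R : Type*} [CommRing R] (M : Matroid α)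
    (C : Submodule R (α →₀ R)) : Prop :=
  (∀ c ∈ C, (c.support : Set α) ⊆ M.E) ∧
    ∀ I ⊆ M.E, M.Indep I ↔ ∀ c ∈ C, (c.support : Set α) ⊆ I → c = 0

/-- The entrywise reduction modulo two of an integer vector. -/
noncomputable def modTwo {α : Type*} (z : α →₀ ℤ) : α →₀ ZMod 2 :=
  z.mapRange Int.cast Int.cast_zero

@[simp] theorem modTwo_apply {α : Type*} (z : α →₀ ℤ) (j : α) : modTwo z j = (z j : ZMod 2) := rfl

/-- The lattice `Λ` consists of integral lifts of the binary space `C`, with every member of `C`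
lifting to a vector with entries in `{0, 1, -1}`, and `Λ` is closed under halving. -/
structure IsUnimodularLift {α : Type*} (Λ : Submodule ℤ (α →₀ ℤ))
    (C : Submodule (ZMod 2) (α →₀ ZMod 2)) : Prop where
  exists_lift : ∀ c ∈ C, ∃ z ∈ Λ, (∀ j, |z j| ≤ 1) ∧ modTwo z = c
  modTwo_mem : ∀ z ∈ Λ, modTwo z ∈ C
  half_mem : ∀ z, (2 : ℤ) • z ∈ Λ → z ∈ Λ

theorem ZMod.two_eq_zero_or_one (x : ZMod 2) : x = 0 ∨ x = 1 := by
  revert x; decide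

theorem ZMod.two_eq_one_of_ne_zero {x : ZMod 2} (h : x ≠ 0) : x = 1 :=
  (ZMod.two_eq_zero_or_one x).resolve_left h

theorem Int.cast_zmod_two_eq_zero_iff (n : ℤ) : (n : ZMod 2) = 0 ↔ (2 : ℤ) ∣ n := by
  simpa using ZMod.intCast_zmod_eq_zero_iff_dvd n 2

theorem modTwo_eq_zero_iff {α : Type*} (z : α →₀ ℤ) :
    modTwo z = 0 ↔ ∃ w : α →₀ ℤ, z = (2 : ℤ) • w := by
  constructor
  · intro h
    refine ⟨z.mapRange (· / 2) (by simp), ?_⟩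
    ext j
    have := (Int.cast_zmod_two_eq_zero_iff (z j)).1 (by simpa using DFunLike.congr_fun h j)
    simp
    omega
  · rintro ⟨w, rfl⟩
    ext j
    have : (2 : ZMod 2) = 0 := rfl
    simp [this]

theorem support_modTwo_subset {α : Type*} (z : α →₀ ℤ) : (modTwo z).support ⊆ z.support := by
  intro j hj
  simp only [Finsupp.mem_support_iff, modTwo_apply] at hj ⊢
  rintro h
  simp [h] at hj

/-- Halving a nonzero vector repeatedly leads to a vector with an odd entry. -/
theorem exists_modTwo_ne_zero {α : Type*} {Λ : Submodule ℤ (α →₀ ℤ)}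
    (hΛ : ∀ z, (2 : ℤ) • z ∈ Λ → z ∈ Λ) {z : α →₀ ℤ} (hz : z ∈ Λ) (hz0 : z ≠ 0) :
    ∃ w ∈ Λ, w.support = z.support ∧ modTwo w ≠ 0 := by
  obtain ⟨j, hj⟩ := Finsupp.ne_iff.1 hz0
  simp only [Finsupp.coe_zero, Pi.zero_apply] at hj
  induction h : (z j).natAbs using Nat.strong_induction_on generalizing z with
  | _ n ih =>
    by_cases hm : modTwo z = 0
    · obtain ⟨w, rfl⟩ := (modTwo_eq_zero_iff z).1 hm
      simp only [Finsupp.smul_apply, smul_eq_mul] at hj h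
      obtain ⟨w', h1, h2, h3⟩ := ih (w j).natAbs (by omega) (hΛ w hz)
        (by rintro rfl; simp at hj) (by omega) rfl
      refine ⟨w', h1, ?_, h3⟩
      rw [h2]
      ext i
      simp
    · exact ⟨z, hz, rfl, hm⟩

/-- Lattice and binary space define the same independent sets: a nonzero lattice vector can be
halved until it has an odd entry and so reduces to a nonzero cycle, while a {0, 1, -1} lift has
exactly the support of its cycle. -/
theorem IsUnimodularLift.forall_eq_zero_iff {α : Type*} {Λ : Submodule ℤ (α →₀ ℤ)}
    {C : Submodule (ZMod 2) (α →₀ ZMod 2)} (h : IsUnimodularLift Λ C) (I : Set α) :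
    (∀ c ∈ C, (c.support : Set α) ⊆ I → c = 0) ↔
      ∀ z ∈ Λ, (z.support : Set α) ⊆ I → z = 0 := by
  constructor
  · intro hC z hz hzI
    by_contra hz0
    obtain ⟨w, hw, hs, hw0⟩ := exists_modTwo_ne_zero h.half_mem hz hz0
    exact hw0 (hC _ (h.modTwo_mem w hw)
      ((Finset.coe_subset.2 ((support_modTwo_subset w).trans hs.subset)).trans hzI))
  · intro hΛ c hc hcI
    obtain ⟨z, hz, hz1, rfl⟩ := h.exists_lift c hc
    have : z = 0 := by
      refine hΛ z hz fun j hj => hcI ?_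
      simp only [Finset.mem_coe, Finsupp.mem_support_iff, modTwo_apply, ne_eq,
        Int.cast_zmod_two_eq_zero_iff] at hj ⊢
      have := abs_le.1 (hz1 j)
      omega
    simp [this, modTwo]

/-! ### Circuits and uniqueness of the binary cycle space. -/

/-- A nonzero finitely supported vector of `C` has a nonzero vector of `C` of minimal support
below it. -/
theorem exists_minimal_support {α R : Type*} [CommRing R] (C : Submodule R (α →₀ R)) {c : α →₀ R}
    (hc : c ∈ C) (hc0 : c ≠ 0) :
    ∃ d ∈ C, d ≠ 0 ∧ d.support ⊆ c.support ∧
      ∀ e ∈ C, e ≠ 0 → e.support ⊆ d.support → e.support = d.support := by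
  induction h : c.support.card using Nat.strong_induction_on generalizing c with
  | _ n ih =>
    by_cases hmin : ∀ e ∈ C, e ≠ 0 → e.support ⊆ c.support → e.support = c.support
    · exact ⟨c, hc, hc0, subset_rfl, hmin⟩
    · push Not at hmin
      obtain ⟨e, he, he0, hec, hne⟩ := hmin
      obtain ⟨d, hd, hd0, hde, hdm⟩ :=
        ih _ (h ▸ Finset.card_lt_card (hec.ssubset_of_ne hne)) he he0 rfl
      exact ⟨d, hd, hd0, hde.trans hec, hdm⟩

theorem Finsupp.eq_of_support_eq_zmod_two {α : Type*} {c d : α →₀ ZMod 2}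
    (h : c.support = d.support) : c = d := by
  ext j
  have := Finset.ext_iff.1 h j
  simp only [Finsupp.mem_support_iff] at this
  rcases ZMod.two_eq_zero_or_one (c j) with h1 | h1 <;>
    rcases ZMod.two_eq_zero_or_one (d j) with h2 | h2 <;> simp_all

theorem Finsupp.support_sub_zmod_two {α : Type*} [DecidableEq α] {c d : α →₀ ZMod 2}
    (h : d.support ⊆ c.support) : (c - d).support = c.support \ d.support := by
  ext j
  have := @h j
  simp only [Finsupp.mem_support_iff, Finset.mem_sdiff, Finsupp.sub_apply] at this ⊢
  rcases ZMod.two_eq_zero_or_one (c j) with h1 | h1 <;>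
    rcases ZMod.two_eq_zero_or_one (d j) with h2 | h2 <;> simp_all

/-- Induction over a binary space by splitting off vectors of minimal support. -/
theorem binary_induction {α : Type*} {C : Submodule (ZMod 2) (α →₀ ZMod 2)}
    {P : (α →₀ ZMod 2) → Prop} (zero : P 0)
    (add : ∀ c ∈ C, ∀ d ∈ C, d ≠ 0 → (∀ e ∈ C, e ≠ 0 → e.support ⊆ d.support → e = d) →
      Disjoint c.support d.support → P c → P (c + d))
    {c : α →₀ ZMod 2} (hc : c ∈ C) : P c := by
  classical
  induction h : c.support.card using Nat.strong_induction_on generalizing c with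
  | _ n ih =>
    by_cases hc0 : c = 0
    · exact hc0 ▸ zero
    obtain ⟨d, hd, hd0, hdc, hdm⟩ := exists_minimal_support C hc hc0
    have hs := Finsupp.support_sub_zmod_two hdc
    have hlt : (c - d).support.card < n := by
      rw [hs, ← h]
      exact Finset.card_lt_card (Finset.sdiff_ssubset hdc (Finsupp.support_nonempty_iff.2 hd0))
    have := add (c - d) (C.sub_mem hc hd) d hd hd0
      (fun e he he0 hed => Finsupp.eq_of_support_eq_zmod_two (hdm e he he0 hed))
      (hs ▸ Finset.sdiff_disjoint) (ih _ hlt (C.sub_mem hc hd) rfl)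
    simpa using this

/-- A binary matroid is represented by a unique binary space. -/
theorem Matroid.IsRepresentedBy.unique {α : Type*} {M : Matroid α}
    {C D : Submodule (ZMod 2) (α →₀ ZMod 2)} (hC : M.IsRepresentedBy C)
    (hD : M.IsRepresentedBy D) : C = D := by
  have key : ∀ {C D : Submodule (ZMod 2) (α →₀ ZMod 2)}, M.IsRepresentedBy C →
      M.IsRepresentedBy D → C ≤ D := by
    intro C D hC hD c hc
    have trans : ∀ {C D : Submodule (ZMod 2) (α →₀ ZMod 2)}, M.IsRepresentedBy C →
        M.IsRepresentedBy D → ∀ c ∈ C, c ≠ 0 → ∃ d ∈ D, d ≠ 0 ∧ d.support ⊆ c.support := by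
      intro C D hC hD c hc hc0
      by_contra! h
      refine hc0 ((hC.2 c.support (hC.1 c hc)).1 ((hD.2 c.support (hC.1 c hc)).2 ?_) c hc subset_rfl)
      intro d hd hdc
      by_contra hd0
      exact h d hd hd0 (Finset.coe_subset.1 hdc)
    refine binary_induction (P := fun c => c ∈ D) D.zero_mem ?_ hc
    intro c _ d hd hd0 hmin _ hcD
    -- Passing from C to D and back stays inside the circuit d, so minimality makes all three
    -- supports equal, and a binary vector is its support.
    obtain ⟨e, he, he0, hed⟩ := trans hC hD d hd hd0
    obtain ⟨f, hf, hf0, hfe⟩ := trans hD hC e he he0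
    have hfd := hmin f hf hf0 (hfe.trans hed)
    subst hfd
    exact D.add_mem hcD (Finsupp.eq_of_support_eq_zmod_two (hed.antisymm hfe) ▸ he)
  exact le_antisymm (key hC hD) (key hD hC)

/-! ### Relations between columns over ℤ, ℚ and `ZMod 2`. -/

/-- The finitely supported linear relations, with supports in `Y`, between the columns of `a`. -/
noncomputable def relations {α ρ R : Type*} [CommRing R] (Y : Set α) (a : Matrix ρ α R) :
    Submodule R (α →₀ R) :=
  Finsupp.supported R R Y ⊓ LinearMap.ker (Finsupp.linearCombination R a.col)

theorem mem_relations {α ρ R : Type*} [CommRing R] {Y : Set α} {a : Matrix ρ α R} {c : α →₀ R} :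
    c ∈ relations Y a ↔
      (c.support : Set α) ⊆ Y ∧ ∀ i, ∑ j ∈ c.support, a i j * c j = 0 := by
  simp only [relations, Submodule.mem_inf, Finsupp.mem_supported, LinearMap.mem_ker,
    Finsupp.linearCombination_apply, Finsupp.sum, funext_iff, Finset.sum_apply, Pi.smul_apply,
    Matrix.col_apply, smul_eq_mul, Pi.zero_apply, mul_comm]

theorem sum_eq_zero_of_mem_relations {α ρ R : Type*} [CommRing R] {Y : Set α} {a : Matrix ρ α R}
    {c : α →₀ R} (hc : c ∈ relations Y a) {F : Finset α} (hF : c.support ⊆ F) (i : ρ) :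
    ∑ j ∈ F, a i j * c j = 0 := by
  rw [← (mem_relations.1 hc).2 i]
  refine (Finset.sum_subset hF fun j _ hj => ?_).symm
  rw [Finsupp.notMem_support_iff.1 hj, mul_zero]

theorem linearIndepOn_col_iff {α ρ R : Type*} [CommRing R] {Y : Set α} (a : Matrix ρ α R)
    {I : Set α} (hI : I ⊆ Y) :
    LinearIndepOn R a.col I ↔ ∀ c ∈ relations Y a, (c.support : Set α) ⊆ I → c = 0 := by
  rw [linearIndepOn_iff]
  constructor
  · intro h c hc hcI
    exact h c ((Finsupp.mem_supported R c).2 hcI) hc.2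
  · intro h c hcI hc
    exact h c ⟨Finsupp.supported_mono hI hcI, hc⟩ ((Finsupp.mem_supported R c).1 hcI)

/-- The independent sets of a vector matroid in terms of an extension of the matrix. -/
theorem Matrix.vectorMatroid_indep_iff_extend {α ρ R : Type*} [Field R] {Y : Set α}
    {A : Matrix ρ Y R} {a : Matrix ρ α R} (ha : ∀ i (j : Y), a i j = A i j) {I : Set α}
    (hI : I ⊆ Y) : A.vectorMatroid.Indep I ↔ LinearIndepOn R a.col I := by
  have hcomp : A.col = a.col ∘ ((↑) : Y → α) := by
    ext j i
    exact (ha i j).symm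
  have himage : ((↑) : Y → α) '' ((↑) ⁻¹' I) = I := by simpa using hI
  rw [Matrix.vectorMatroid_indep_iff, hcomp]
  constructor
  · rintro ⟨-, h⟩
    simpa [himage] using h.image_of_comp _ _
  · intro h
    exact ⟨hI, LinearIndepOn.comp_of_image (by rwa [himage]) Subtype.val_injective.injOn⟩

theorem Matrix.vectorMatroid_isRepresentedBy {α ρ R : Type*} [Field R] {Y : Set α}
    {A : Matrix ρ Y R} {a : Matrix ρ α R} (ha : ∀ i (j : Y), a i j = A i j) :
    A.vectorMatroid.IsRepresentedBy (relations Y a) :=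
  ⟨fun _ hc => (mem_relations.1 hc).1, fun _ hI =>
    (A.vectorMatroid_indep_iff_extend ha hI).trans (linearIndepOn_col_iff a hI)⟩

theorem linearIndepOn_int_iff_rat {α ρ : Type*} (a : Matrix ρ α ℤ) (I : Set α) :
    LinearIndepOn ℤ a.col I ↔ LinearIndepOn ℚ (a.map (Int.cast : ℤ → ℚ)).col I := by
  rw [LinearIndepOn, LinearIndepOn, ← LinearIndependent.iff_fractionRing ℤ ℚ]
  let φ : (ρ → ℤ) →ₗ[ℤ] (ρ → ℚ) := (Int.castAddHom ℚ).toIntLinearMap.compLeft ρ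
  have hφ : Function.Injective φ := fun x y h => funext fun i => by
    simpa [φ] using congrFun h i
  exact (φ.linearIndependent_iff_of_injOn hφ.injOn).symm

theorem Matrix.vectorMatroid_isRepresentedBy_int {α ρ : Type*} {Y : Set α}
    {A : Matrix ρ Y ℚ} {a : Matrix ρ α ℤ} (ha : ∀ i (j : Y), (a i j : ℚ) = A i j) :
    A.vectorMatroid.IsRepresentedBy (relations Y a) :=
  ⟨fun _ hc => (mem_relations.1 hc).1, fun _ hI =>
    (A.vectorMatroid_indep_iff_extend (a := a.map Int.cast) ha hI).trans
      ((linearIndepOn_int_iff_rat a _).symm.trans (linearIndepOn_col_iff a hI))⟩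

/-! ### Totally unimodular matrices: minors, reduction modulo two and lifts of circuits. -/

/-- A matrix with linearly independent columns has a nonsingular square submatrix using all its
columns. -/
theorem Matrix.exists_submatrix_det_ne_zero {ρ ι K : Type*} [Field K] [Fintype ι] [DecidableEq ι]
    (B : Matrix ρ ι K) (hB : LinearIndependent K B.col) :
    ∃ f : ι → ρ, (B.submatrix f id).det ≠ 0 := by
  -- The coefficients of a nonzero functional vanishing on all rows would be a nontrivial relation
  -- between the columns.
  have hspan : Submodule.span K (range B.row) = ⊤ := by
    by_contra hne
    obtain ⟨φ, hφ, hle⟩ := Submodule.exists_le_ker_of_lt_top _ (lt_top_iff_ne_top.2 hne)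
    have hx : ∀ y : ι → K, φ y = ∑ j, φ (Pi.single j 1) * y j := by
      intro y
      conv_lhs => rw [pi_eq_sum_univ' y]
      simp [mul_comm]
    have h0 := Fintype.linearIndependent_iff.1 hB (fun j => φ (Pi.single j 1)) (by
      ext i
      have := hle (Submodule.subset_span (mem_range_self i))
      rw [LinearMap.mem_ker, hx] at this
      simpa using this)
    exact hφ (LinearMap.ext fun y => by rw [hx]; simp [h0])
  obtain ⟨f, hf, -, hli⟩ := Submodule.exists_fun_fin_finrank_span_eq K (range B.row)
  have hcard : Module.finrank K (Submodule.span K (range B.row)) = Fintype.card ι := by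
    rw [hspan, finrank_top, Module.finrank_fintype_fun_eq_card]
  choose g hg using hf
  let e : ι ≃ Fin (Module.finrank K (Submodule.span K (range B.row))) :=
    (Fintype.equivFin ι).trans (finCongr hcard.symm)
  refine ⟨g ∘ e, IsUnit.ne_zero ((Matrix.isUnit_iff_isUnit_det _).1 ?_)⟩
  rw [← Matrix.linearIndependent_rows_iff_isUnit]
  have hrow : (B.submatrix (g ∘ e) id).row = f ∘ e := by
    ext i j
    simp [← hg]
  rw [hrow]
  exact hli.comp e e.injective

theorem Matrix.IsTotallyUnimodular.exists_isUnit_det {α ρ : Type*} {a : Matrix ρ α ℤ}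
    (ha : a.IsTotallyUnimodular) {ι : Type*} [Fintype ι] [DecidableEq ι] (g : ι → α)
    (h : LinearIndependent ℚ ((a.map (Int.cast : ℤ → ℚ)).submatrix id g).col) :
    ∃ f : ι → ρ, IsUnit (a.submatrix f g).det := by
  obtain ⟨f, hf⟩ := Matrix.exists_submatrix_det_ne_zero _ h
  refine ⟨f, ?_⟩
  have hne : (a.submatrix f g).det ≠ 0 := by
    intro h0
    apply hf
    have := congrArg (Int.cast : ℤ → ℚ) h0
    rw [Int.cast_det] at this
    simpa [Matrix.submatrix_map] using this
  obtain ⟨s, hs⟩ := (Matrix.isTotallyUnimodular_iff_fintype a).1 ha ι f g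
  rw [← hs] at hne ⊢
  rw [Int.isUnit_iff]
  cases s <;> simp_all

theorem Matrix.IsTotallyUnimodular.exists_isUnit_det_of_linearIndepOn {α ρ : Type*}
    [DecidableEq α] {a : Matrix ρ α ℤ} (ha : a.IsTotallyUnimodular) {D : Finset α}
    (h : LinearIndepOn ℤ a.col (D : Set α)) :
    ∃ f : D → ρ, IsUnit (a.submatrix f (Subtype.val : D → α)).det :=
  ha.exists_isUnit_det _ ((linearIndepOn_int_iff_rat a D).1 h)

theorem modTwo_mem_relations {α ρ : Type*} {Y : Set α} {a : Matrix ρ α ℤ} {z : α →₀ ℤ}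
    (hz : z ∈ relations Y a) : modTwo z ∈ relations Y (a.map (Int.cast : ℤ → ZMod 2)) := by
  refine mem_relations.2 ⟨(Finset.coe_subset.2 (support_modTwo_subset z)).trans
    (mem_relations.1 hz).1, fun i => ?_⟩
  rw [Finset.sum_subset (support_modTwo_subset z) fun j _ hj => by
    rw [Finsupp.notMem_support_iff.1 hj, mul_zero]]
  have := congrArg (Int.cast : ℤ → ZMod 2) ((mem_relations.1 hz).2 i)
  push_cast at this
  simpa using this

theorem mem_relations_of_smul_mem {α ρ : Type*} {Y : Set α} {a : Matrix ρ α ℤ} {z : α →₀ ℤ} {n : ℤ}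
    (hn : n ≠ 0) (hz : n • z ∈ relations Y a) : z ∈ relations Y a := by
  obtain ⟨h1, h2⟩ := mem_relations.1 hz
  have hs : (n • z).support = z.support := by
    ext j
    simp [hn]
  rw [hs] at h1 h2
  refine mem_relations.2 ⟨h1, fun i => ?_⟩
  have := h2 i
  simp only [Finsupp.smul_apply, smul_eq_mul, mul_left_comm _ n, ← Finset.mul_sum] at this
  exact (mul_eq_zero.1 this).resolve_left hn

/-- An integral relation can be halved until it survives reduction. Conversely, integrally
independent columns contain a full minor equal to ±1, which stays nonzero modulo two. -/
theorem linearIndepOn_zmod_two_iff {α ρ : Type*} {a : Matrix ρ α ℤ} (ha : a.IsTotallyUnimodular)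
    (I : Set α) :
    LinearIndepOn (ZMod 2) (a.map (Int.cast : ℤ → ZMod 2)).col I ↔ LinearIndepOn ℤ a.col I := by
  classical
  constructor
  · intro h
    rw [linearIndepOn_col_iff _ subset_rfl] at h ⊢
    intro z hz hzI
    by_contra hz0
    obtain ⟨w, hw, hs, hw0⟩ := exists_modTwo_ne_zero
      (fun z hz => mem_relations_of_smul_mem two_ne_zero hz) hz hz0
    exact hw0 (h _ (modTwo_mem_relations hw)
      ((Finset.coe_subset.2 ((support_modTwo_subset w).trans hs.subset)).trans hzI))
  · intro h
    rw [linearIndepOn_col_iff _ subset_rfl]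
    intro c hc hcI
    obtain ⟨f, hf⟩ := ha.exists_isUnit_det_of_linearIndepOn (h.mono hcI)
    have hdet : ((a.map (Int.cast : ℤ → ZMod 2)).submatrix f
        (Subtype.val : c.support → α)).det ≠ 0 := by
      have := hf.map (Int.castRingHom (ZMod 2))
      rw [RingHom.map_det] at this
      exact this.ne_zero
    have h0 := Matrix.eq_zero_of_mulVec_eq_zero hdet (v := fun j => c j) (by
      ext r
      rw [Pi.zero_apply, ← (mem_relations.1 hc).2 (f r), ← Finset.sum_coe_sort]
      rfl)
    ext j
    by_contra hj
    exact hj (congrFun h0 ⟨j, Finsupp.mem_support_iff.2 hj⟩)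

/-- A circuit of a totally unimodular matrix carries a relation with entries in `{0, 1, -1}`. -/
theorem Matrix.IsTotallyUnimodular.exists_circuit_lift {α ρ : Type*} {Y : Set α}
    {a : Matrix ρ α ℤ} (ha : a.IsTotallyUnimodular) {d : α →₀ ZMod 2}
    (hd : d ∈ relations Y (a.map (Int.cast : ℤ → ZMod 2))) (hd0 : d ≠ 0)
    (hmin : ∀ e ∈ relations Y (a.map (Int.cast : ℤ → ZMod 2)), e ≠ 0 →
      e.support ⊆ d.support → e = d) :
    ∃ z ∈ relations Y a, (∀ j, |z j| ≤ 1) ∧ modTwo z = d := by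
  classical
  have hdY := (mem_relations.1 hd).1
  have hdep : ¬ LinearIndepOn ℤ a.col (d.support : Set α) := by
    rw [← linearIndepOn_zmod_two_iff ha, linearIndepOn_col_iff _ hdY]
    exact fun h => hd0 (h d hd subset_rfl)
  rw [linearIndepOn_col_iff _ hdY] at hdep
  push Not at hdep
  obtain ⟨z, hz, hzd, hz0⟩ := hdep
  obtain ⟨w, hw, hws, hw0⟩ := exists_modTwo_ne_zero
    (fun z hz => mem_relations_of_smul_mem two_ne_zero hz) hz hz0
  have hwd : w.support ⊆ d.support := hws.subset.trans (Finset.coe_subset.1 hzd)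
  have hmod : modTwo w = d :=
    hmin _ (modTwo_mem_relations hw) hw0 ((support_modTwo_subset w).trans hwd)
  obtain ⟨e, he⟩ := Finsupp.support_nonempty_iff.2 hd0
  have hindep : LinearIndepOn ℤ a.col ((d.support.erase e : Finset α) : Set α) := by
    have hsub : d.support.erase e ⊆ d.support := Finset.erase_subset _ _
    rw [← linearIndepOn_zmod_two_iff ha,
      linearIndepOn_col_iff _ ((Finset.coe_subset.2 hsub).trans hdY)]
    intro c hc hcs
    by_contra hc0
    have := hmin c hc hc0 ((Finset.coe_subset.1 hcs).trans hsub)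
    subst this
    exact Finset.notMem_erase e _ (Finset.coe_subset.1 hcs he)
  obtain ⟨f, hf⟩ := ha.exists_isUnit_det_of_linearIndepOn hindep
  set N := a.submatrix f (Subtype.val : d.support.erase e → α) with hN
  let b : d.support.erase e → ℤ := fun r => a (f r) e
  have hwe : w e ≠ 0 := Finsupp.mem_support_iff.1 (support_modTwo_subset w (hmod ▸ he))
  have hsol : N.mulVec (fun j => w j) = -(w e • b) := by
    ext r
    have := sum_eq_zero_of_mem_relations hw hwd (f r)
    rw [← Finset.add_sum_erase _ _ he, ← Finset.sum_coe_sort] at this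
    have h2 : N.mulVec (fun j => w j) r = ∑ j : d.support.erase e, a (f r) j * w j := rfl
    simp only [h2, Pi.neg_apply, Pi.smul_apply, smul_eq_mul, b]
    linarith
  -- Cramer's rule for the relation w, with the column of e moved to the right-hand side.
  have hcramer : N.det • (fun j : d.support.erase e => w j) + w e • N.cramer b = 0 := by
    refine Matrix.eq_zero_of_mulVec_eq_zero hf.ne_zero ?_
    rw [Matrix.mulVec_add, Matrix.mulVec_smul, Matrix.mulVec_smul, Matrix.mulVec_cramer, hsol,
      smul_neg, smul_comm]
    simp
  have habs : ∀ j ∈ d.support, |w j| = |w e| := by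
    intro j hj
    by_cases hje : j = e
    · rw [hje]
    have hj' : j ∈ d.support.erase e := Finset.mem_erase.2 ⟨hje, hj⟩
    have h1 := congrFun hcramer ⟨j, hj'⟩
    simp only [Pi.add_apply, Pi.smul_apply, smul_eq_mul, Pi.zero_apply] at h1
    -- The Cramer numerator is again a minor of `a`, hence 0 or ±1. As w j is nonzero and N has
    -- determinant ±1, this forces |w j| = |w e|.
    have hupd : N.updateCol ⟨j, hj'⟩ b = a.submatrix f (Function.update Subtype.val ⟨j, hj'⟩ e) := by
      ext r i
      by_cases hi : i = ⟨j, hj'⟩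
      · subst hi
        simp [b]
      · simp [hi, hN]
    rw [Matrix.cramer_apply, hupd] at h1
    obtain ⟨s, hs⟩ := (Matrix.isTotallyUnimodular_iff_fintype a).1 ha _ f
      (Function.update Subtype.val ⟨j, hj'⟩ e)
    rw [← hs] at h1
    have hwj : w j ≠ 0 := Finsupp.mem_support_iff.1 (support_modTwo_subset w (hmod ▸ hj))
    have hprod : N.det * w j = - (w e * s) := by linarith
    have hdet : |N.det| = 1 := by
      rcases Int.isUnit_iff.1 hf with h | h <;> simp [h]
    have := congrArg abs hprod
    rw [abs_mul, hdet, one_mul, abs_neg, abs_mul] at this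
    have hs' : (s : ℤ) = 0 ∨ |(s : ℤ)| = 1 := by cases s <;> simp
    rcases hs' with h | h
    · rw [h, abs_zero, mul_zero, abs_eq_zero] at this
      exact absurd this hwj
    · rw [this, h, mul_one]
  -- All entries of w on the circuit have absolute value |w e|, so the sign vector is w divided by
  -- |w e|.
  refine ⟨w.mapRange Int.sign Int.sign_zero, mem_relations_of_smul_mem (abs_ne_zero.2 hwe) ?_, ?_, ?_⟩
  · convert hw using 1
    ext j
    by_cases hj : j ∈ d.support
    · rw [← habs j hj, Finsupp.smul_apply, Finsupp.mapRange_apply, smul_eq_mul, mul_comm,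
        Int.sign_mul_abs]
    · simp [Finsupp.notMem_support_iff.1 (fun h => hj (hwd h))]
  · intro j
    simp only [Finsupp.mapRange_apply]
    rcases lt_trichotomy (w j) 0 with h | h | h
    · simp [Int.sign_eq_neg_one_of_neg h]
    · simp [h]
    · simp [Int.sign_eq_one_of_pos h]
  · ext j
    by_cases hj : j ∈ d.support
    · have hwj : w j ≠ 0 := Finsupp.mem_support_iff.1 (support_modTwo_subset w (hmod ▸ hj))
      rw [ZMod.two_eq_one_of_ne_zero (Finsupp.mem_support_iff.1 hj)]
      rcases lt_or_gt_of_ne hwj with h | h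
      · simp [Int.sign_eq_neg_one_of_neg h]
      · simp [Int.sign_eq_one_of_pos h]
    · simp [Finsupp.notMem_support_iff.1 (fun h => hj (hwd h)), Finsupp.notMem_support_iff.1 hj]

theorem eq_zero_of_abs_le_one_of_cast_eq_zero {n : ℤ} (h : |n| ≤ 1) (h0 : (n : ZMod 2) = 0) :
    n = 0 := by
  rw [Int.cast_zmod_two_eq_zero_iff] at h0
  have := abs_le.1 h
  omega

/-- A binary cycle is a disjoint union of circuits. Each circuit has a {0, 1, -1} lift, and lifts
with disjoint supports add without creating larger entries. -/
theorem Matrix.IsTotallyUnimodular.isUnimodularLift {α ρ : Type*} (Y : Set α)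
    {a : Matrix ρ α ℤ} (ha : a.IsTotallyUnimodular) :
    IsUnimodularLift (relations Y a) (relations Y (a.map (Int.cast : ℤ → ZMod 2))) where
  exists_lift := by
    refine fun c hc => binary_induction
      (P := fun c => ∃ z ∈ relations Y a, (∀ j, |z j| ≤ 1) ∧ modTwo z = c)
      ⟨0, Submodule.zero_mem _, by simp, by simp [modTwo]⟩ ?_ hc
    rintro _ - d hd hd0 hmin hdisj ⟨z, hz, hz1, rfl⟩
    obtain ⟨w, hw, hw1, rfl⟩ := ha.exists_circuit_lift hd hd0 hmin
    refine ⟨z + w, Submodule.add_mem _ hz hw, fun j => ?_, by ext j; simp⟩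
    by_cases hj : j ∈ (modTwo z).support
    · have := eq_zero_of_abs_le_one_of_cast_eq_zero (hw1 j)
        (Finsupp.notMem_support_iff.1 (Finset.disjoint_left.1 hdisj hj))
      simpa [this] using hz1 j
    · have := eq_zero_of_abs_le_one_of_cast_eq_zero (hz1 j) (Finsupp.notMem_support_iff.1 hj)
      simpa [this] using hw1 j
  modTwo_mem _ := modTwo_mem_relations
  half_mem _ := mem_relations_of_smul_mem two_ne_zero

/-- A regular matroid is represented by a binary space with a unimodular lift. -/
theorem Matroid.IsRegular.exists_isUnimodularLift {α : Type*} {M : Matroid α} (hM : M.IsRegular) :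
    ∃ (Λ : Submodule ℤ (α →₀ ℤ)) (C : Submodule (ZMod 2) (α →₀ ZMod 2)),
      M.IsRepresentedBy C ∧ IsUnimodularLift Λ C := by
  classical
  obtain ⟨X, Y, A, hA, rfl⟩ := hM
  choose s hs using fun i j => hA.apply i j
  let a : Matrix X α ℤ := fun i j => if h : j ∈ Y then (s i ⟨j, h⟩ : ℤ) else 0
  have haA : ∀ i (j : Y), (a i j : ℚ) = A i j := by
    intro i j
    simp only [a, j.2, dite_true, ← hs i j]
    cases s i j <;> simp
  have ha : a.IsTotallyUnimodular := by
    intro k f g _ _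
    by_cases hg : ∀ r, g r ∈ Y
    · obtain ⟨t, ht⟩ := (Matrix.isTotallyUnimodular_iff A).1 hA k f (fun r => ⟨g r, hg r⟩)
      refine ⟨t, Int.cast_injective (α := ℚ) ?_⟩
      have : (a.submatrix f g).map (Int.cast : ℤ → ℚ) = A.submatrix f (fun r => ⟨g r, hg r⟩) := by
        ext i j
        exact haA (f i) ⟨g j, hg j⟩
      rw [Int.cast_det, this, ← ht]
      cases t <;> simp
    · push Not at hg
      obtain ⟨r, hr⟩ := hg
      exact ⟨0, (Matrix.det_eq_zero_of_column_eq_zero r fun i => dif_neg hr).symm⟩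
  refine ⟨_, _, ?_, ha.isUnimodularLift Y⟩
  obtain ⟨h1, h2⟩ := Matrix.vectorMatroid_isRepresentedBy_int haA
  refine ⟨fun c hc => (mem_relations.1 hc).1, fun I hI => (h2 I hI).trans ?_⟩
  exact ((ha.isUnimodularLift Y).forall_eq_zero_iff I).symm

/-! ### From a unimodular lift to a totally unimodular matrix. -/

theorem support_modTwo_of_abs_le_one {α : Type*} {z : α →₀ ℤ} (hz : ∀ j, |z j| ≤ 1) :
    (modTwo z).support = z.support := by
  refine (support_modTwo_subset z).antisymm fun j hj => ?_
  rw [Finsupp.mem_support_iff] at hj ⊢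
  exact fun h => hj (eq_zero_of_abs_le_one_of_cast_eq_zero (hz j) h)

theorem Int.mul_self_eq_one_of_abs_le_one {n : ℤ} (h : |n| ≤ 1) (h0 : n ≠ 0) : n * n = 1 := by
  have := abs_le.1 h
  obtain rfl | rfl : n = 1 ∨ n = -1 := by omega
  all_goals norm_num

/-- Modulo the lattice, an element of the ground set is an integral combination of a base. -/
theorem Matroid.IsRepresentedBy.exists_coords {α : Type*} {M : Matroid α}
    {C : Submodule (ZMod 2) (α →₀ ZMod 2)} {Λ : Submodule ℤ (α →₀ ℤ)} (hM : M.IsRepresentedBy C)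
    (h : IsUnimodularLift Λ C) {B : Set α} (hB : M.IsBase B) {e : α} (he : e ∈ M.E) :
    ∃ v : α →₀ ℤ, (v.support : Set α) ⊆ B ∧ Finsupp.single e 1 - v ∈ Λ := by
  classical
  by_cases heB : e ∈ B
  · refine ⟨Finsupp.single e 1, ?_, by simp⟩
    intro j hj
    obtain rfl : j = e := by simpa using Finsupp.support_single_subset hj
    exact heB
  have hins : insert e B ⊆ M.E := insert_subset he hB.subset_ground
  have hdep : ¬ M.Indep (insert e B) := (hB.insert_dep ⟨he, heB⟩).not_indep
  rw [hM.2 _ hins] at hdep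
  push Not at hdep
  obtain ⟨c, hc, hcs, hc0⟩ := hdep
  obtain ⟨z, hz, hz1, rfl⟩ := h.exists_lift c hc
  rw [support_modTwo_of_abs_le_one hz1] at hcs
  have hze : z e ≠ 0 := by
    intro h0
    refine hc0 ((hM.2 B hB.subset_ground).1 hB.indep _ hc ?_)
    rw [support_modTwo_of_abs_le_one hz1]
    intro j hj
    refine (hcs hj).resolve_left ?_
    rintro rfl
    exact Finsupp.mem_support_iff.1 hj h0
  -- Here z e = ±1, so z e • z has entry 1 at e and the difference lives on the base.
  refine ⟨Finsupp.single e 1 - z e • z, ?_, by simpa using Λ.smul_mem _ hz⟩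
  intro j hj
  rw [Finset.mem_coe, Finsupp.mem_support_iff] at hj
  by_cases hje : j = e
  · subst hje
    simp [Int.mul_self_eq_one_of_abs_le_one (hz1 j) hze] at hj
  · refine (hcs (Finsupp.mem_support_iff.2 fun h0 => hj ?_)).resolve_left hje
    simp [h0, Ne.symm hje]

theorem Finsupp.sum_support_eq_sum_of_injective {α ι R : Type*} [Fintype ι] [CommRing R]
    (z : α →₀ R) (u : α → R) {g : ι → α} (hg : g.Injective)
    (h : ∀ j ∉ range g, u j * z j = 0) : ∑ j ∈ z.support, u j * z j = ∑ s, u (g s) * z (g s) := by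
  classical
  rw [← Finset.sum_image (s := Finset.univ) (g := g) (f := fun j => u j * z j) hg.injOn]
  rw [Finset.sum_subset (Finset.subset_union_left (s₂ := Finset.univ.image g))
    fun j _ hj => by rw [Finsupp.notMem_support_iff.1 hj, mul_zero]]
  refine (Finset.sum_subset Finset.subset_union_right fun j _ hj => h j ?_).symm
  simpa using hj

/-- A matroid represented by a binary space with a unimodular lift is regular. -/
theorem Matroid.IsRepresentedBy.isRegular {α : Type*} {M : Matroid α}
    {C : Submodule (ZMod 2) (α →₀ ZMod 2)} {Λ : Submodule ℤ (α →₀ ℤ)} (hM : M.IsRepresentedBy C)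
    (h : IsUnimodularLift Λ C) : M.IsRegular := by
  classical
  obtain ⟨B, hB⟩ := M.exists_isBase
  have hind : ∀ I ⊆ M.E, M.Indep I ↔ ∀ z ∈ Λ, (z.support : Set α) ⊆ I → z = 0 :=
    fun I hI => (hM.2 I hI).trans (h.forall_eq_zero_iff I)
  have hBz := (hind B hB.subset_ground).1 hB.indep
  choose v hvB hvΛ using fun e : M.E => hM.exists_coords h hB e.2
  have hvb : ∀ e : M.E, (e : α) ∈ B → v e = Finsupp.single (e : α) 1 := by
    intro e he
    refine (sub_eq_zero.1 (hBz _ (hvΛ e) ?_)).symm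
    refine (Finset.coe_subset.2 Finsupp.support_sub).trans ?_
    rw [Finset.coe_union]
    refine union_subset (fun j hj => ?_) (hvB e)
    obtain rfl : j = e := by simpa using Finsupp.support_single_subset hj
    exact he
  let a : Matrix B α ℤ := fun i j => if hj : j ∈ M.E then v ⟨j, hj⟩ i else 0
  have ha : ∀ i (j : M.E), a i j = v j i := fun i j => dif_pos j.2
  let A : Matrix B M.E ℚ := fun i j => (v j i : ℚ)
  have haA : ∀ i (j : M.E), (a i j : ℚ) = A i j := fun i j => by rw [ha]
  -- Modulo Λ, z equals its coordinate vector t on the base. A lattice vector supported on the base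
  -- is zero, so z lies in Λ exactly when t = 0, that is, when z is a relation of `a`.
  have hrel : ∀ z : α →₀ ℤ, (z.support : Set α) ⊆ M.E → (z ∈ relations M.E a ↔ z ∈ Λ) := by
    intro z hzE
    let t : α →₀ ℤ := ∑ j : z.support, z j • v ⟨j, hzE j.2⟩
    have hzt : z - t ∈ Λ := by
      have : z - t = ∑ j : z.support, z j • (Finsupp.single (j : α) 1 - v ⟨j, hzE j.2⟩) := by
        simp only [smul_sub, Finset.sum_sub_distrib, t]
        congr 1
        conv_lhs => rw [← Finsupp.sum_single z, Finsupp.sum, ← Finset.sum_coe_sort]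
        simp
      rw [this]
      exact Λ.sum_mem fun j _ => Λ.smul_mem _ (hvΛ _)
    have htB : (t.support : Set α) ⊆ B := by
      intro j hj
      by_contra hjB
      refine Finsupp.mem_support_iff.1 hj ?_
      simp only [t, Finsupp.finsetSum_apply, Finsupp.smul_apply]
      refine Finset.sum_eq_zero fun i _ => ?_
      rw [Finsupp.notMem_support_iff.1 fun hi => hjB (hvB _ hi), smul_zero]
    have hti : ∀ i : B, t i = ∑ j ∈ z.support, a i j * z j := by
      intro i
      rw [← Finset.sum_coe_sort]
      simp only [t, Finsupp.finsetSum_apply, Finsupp.smul_apply, smul_eq_mul]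
      refine Finset.sum_congr rfl fun j _ => ?_
      rw [ha i ⟨j, hzE j.2⟩, mul_comm]
    have htz : z ∈ Λ ↔ t = 0 := by
      constructor
      · intro hz
        exact hBz t (by simpa using Λ.sub_mem hz hzt) htB
      · intro ht
        simpa [ht] using hzt
    rw [htz, mem_relations]
    constructor
    · rintro ⟨-, hz⟩
      ext j
      by_cases hj : j ∈ B
      · exact (hti ⟨j, hj⟩).trans (hz _)
      · exact Finsupp.notMem_support_iff.1 fun hi => hj (htB hi)
    · rintro ht
      exact ⟨hzE, fun i => by rw [← hti, ht]; rfl⟩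
  refine ⟨B, M.E, A, ?_, ?_⟩
  · intro k f g hf hg
    let N : Matrix (Fin k) (Fin k) ℤ := Matrix.of fun r s => v (g s) (f r)
    have hNA : A.submatrix f g = N.map (Int.cast : ℤ → ℚ) := rfl
    have hg' : Function.Injective fun s => (g s : α) := Subtype.val_injective.comp hg
    have hf' : Function.Injective fun s => (f s : α) := Subtype.val_injective.comp hf
    suffices hN : N.det = 0 ∨ IsUnit N.det by
      rw [hNA, ← Int.cast_det]
      rcases hN with hN | hN
      · exact ⟨0, by simp [hN]⟩
      · rcases Int.isUnit_iff.1 hN with hN | hN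
        · exact ⟨1, by simp [hN]⟩
        · exact ⟨-1, by simp [hN]⟩
    refine or_iff_not_imp_left.2 fun hN => ?_
    -- Solving for every unit vector over ℤ gives an integral right inverse of N, so its determinant
    -- is ±1.
    have hsolve : ∀ r, ∃ y, N.mulVec y = Pi.single r 1 := by
      intro r
      by_cases hr : ∃ s, (g s : α) = f r
      · obtain ⟨s, hs⟩ := hr
        refine ⟨Pi.single s 1, ?_⟩
        ext i
        have : v (g s) = Finsupp.single (f r : α) 1 := by
          rw [hvb (g s) (hs ▸ (f r).2), hs]
        simp [N, this, Finsupp.single_apply, Pi.single_apply, Subtype.ext_iff.symm, hf.eq_iff,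
          eq_comm]
      -- The base with the row elements of N exchanged for its column elements. Nonsingularity of N
      -- makes I independent.
      let I : Set α := range (fun s => (g s : α)) ∪ B \ range (fun s => (f s : α))
      have hIE : insert (f r : α) I ⊆ M.E := by
        refine insert_subset (hB.subset_ground (f r).2) (union_subset ?_ ?_)
        · rintro _ ⟨s, rfl⟩
          exact (g s).2
        · exact sdiff_subset.trans hB.subset_ground
      -- The remaining elements of the base are unit columns vanishing on the rows of N, so only the
      -- columns of N and the unit column f r contribute.
      have hkey : ∀ z ∈ Λ, (z.support : Set α) ⊆ insert (f r : α) I →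
          N.mulVec (fun s => z (g s)) = -(z (f r) • Pi.single r 1) := by
        intro z hz hzI
        have hz' := (mem_relations.1 ((hrel z (hzI.trans hIE)).2 hz)).2
        have hupd : ∀ i : Fin k, ∑ j ∈ z.support, a (f i) j * z j
            = (∑ s, N i s * z (g s)) + (Pi.single r 1 : Fin k → ℤ) i * z (f r) := by
          intro i
          have hinj : Function.Injective
              (fun o : Option (Fin k) => o.elim (f r : α) fun s => (g s : α)) := by
            rintro (_ | s) (_ | t) hst
            · rfl
            · exact absurd ⟨t, hst.symm⟩ hr
            · exact absurd ⟨s, hst⟩ hr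
            · exact congrArg some (hg' hst)
          rw [Finsupp.sum_support_eq_sum_of_injective z _ hinj, Fintype.sum_option, add_comm]
          · congr 1
            · refine Finset.sum_congr rfl fun s _ => ?_
              simp only [Option.elim_some, ha]
              rfl
            · have : v ⟨f r, hB.subset_ground (f r).2⟩ = Finsupp.single (f r : α) 1 :=
                hvb _ (f r).2
              simp only [Option.elim_none]
              rw [ha (f i) ⟨f r, hB.subset_ground (f r).2⟩, this]
              simp [Finsupp.single_apply, Pi.single_apply, Subtype.ext_iff.symm, hf.eq_iff,
                eq_comm]
          · intro j hj
            by_cases hjz : z j = 0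
            · rw [hjz, mul_zero]
            have hjI := hzI (Finsupp.mem_support_iff.2 hjz)
            have hjr : j ≠ f r := fun h => hj ⟨none, h.symm⟩
            have hjg : j ∉ range fun s => (g s : α) := fun ⟨s, hs⟩ => hj ⟨some s, hs⟩
            obtain ⟨hjB, hjf⟩ := (hjI.resolve_left hjr).resolve_left hjg
            have : v ⟨j, hB.subset_ground hjB⟩ = Finsupp.single j 1 := hvb _ hjB
            rw [ha (f i) ⟨j, hB.subset_ground hjB⟩, this, Finsupp.single_apply,
              if_neg fun h => hjf ⟨i, h.symm⟩, zero_mul]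
        ext i
        have := hz' (f i)
        rw [hupd] at this
        simp only [Matrix.mulVec, dotProduct, Pi.neg_apply, Pi.smul_apply, smul_eq_mul]
        linarith
      have hI0 : ∀ z ∈ Λ, (z.support : Set α) ⊆ I → z = 0 := by
        intro z hz hzI
        have hfr : z (f r) = 0 := by
          by_contra h0
          rcases hzI (Finsupp.mem_support_iff.2 h0) with ⟨s, hs⟩ | ⟨-, hs⟩
          · exact hr ⟨s, hs⟩
          · exact hs ⟨r, rfl⟩
        have hzg := hkey z hz (hzI.trans (subset_insert _ _))
        rw [hfr, zero_smul, neg_zero] at hzg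
        have hzg0 := Matrix.eq_zero_of_mulVec_eq_zero hN hzg
        refine hBz z hz fun j hj => ?_
        rcases hzI hj with ⟨s, rfl⟩ | ⟨hjB, -⟩
        · exact absurd (congrFun hzg0 s) (Finsupp.mem_support_iff.1 hj)
        · exact hjB
      -- Since N y = det N • e_r, the vector w witnesses that adding f r to I gives a dependent set.
      -- Its entries may be large, so it is then traded for a {0, 1, -1} lift z of a binary cycle; z
      -- is ±1 at f r because I is independent.
      let y := N.cramer (Pi.single r 1)
      let w : α →₀ ℤ := ∑ s, y s • (Finsupp.single (g s : α) 1 - v (g s))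
      have hwΛ : w ∈ Λ := Λ.sum_mem fun s _ => Λ.smul_mem _ (hvΛ (g s))
      have hwg : ∀ j ∉ range (fun s => (g s : α)), w j = -∑ s, v (g s) j * y s := by
        intro j hj
        simp only [w, Finsupp.finsetSum_apply, Finsupp.smul_apply, Finsupp.sub_apply, smul_eq_mul]
        rw [← Finset.sum_neg_distrib]
        refine Finset.sum_congr rfl fun s _ => ?_
        rw [Finsupp.single_apply, if_neg fun h => hj ⟨s, h⟩]
        ring
      have hwf : ∀ i, (f i : α) ∉ range (fun s => (g s : α)) →
          w (f i) = -(N.det * (Pi.single r 1 : Fin k → ℤ) i) := by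
        intro i hi
        rw [hwg _ hi]
        exact congrArg Neg.neg (congrFun (Matrix.mulVec_cramer N (Pi.single r 1)) i)
      have hw0 : w ≠ 0 := by
        intro h0
        have := hwf r hr
        rw [h0] at this
        simp [hN] at this
      have hwI : (w.support : Set α) ⊆ insert (f r : α) I := by
        intro j hj
        by_contra hjI
        refine Finsupp.mem_support_iff.1 hj ?_
        simp only [mem_insert_iff, I, mem_union, mem_sdiff, not_or, not_and, not_not] at hjI
        obtain ⟨hjr, hjg, hjB⟩ := hjI
        by_cases hj' : j ∈ B
        · obtain ⟨i, rfl⟩ := hjB hj'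
          rw [hwf i hjg, Pi.single_eq_of_ne (fun h => hjr (by rw [h])), mul_zero, neg_zero]
        · rw [hwg j hjg, neg_eq_zero]
          refine Finset.sum_eq_zero fun s _ => ?_
          rw [Finsupp.notMem_support_iff.1 fun h => hj' (hvB _ h), zero_mul]
      have hdep : ¬ ∀ c ∈ C, (c.support : Set α) ⊆ insert (f r : α) I → c = 0 :=
        fun H => hw0 ((h.forall_eq_zero_iff _).1 H w hwΛ hwI)
      push Not at hdep
      obtain ⟨c, hc, hcI, hc0⟩ := hdep
      obtain ⟨z, hz, hz1, rfl⟩ := h.exists_lift c hc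
      rw [support_modTwo_of_abs_le_one hz1] at hcI
      have hzr : z (f r) ≠ 0 := by
        intro h0
        refine hc0 ((h.forall_eq_zero_iff I).2 hI0 _ hc ?_)
        rw [support_modTwo_of_abs_le_one hz1]
        intro j hj
        refine (hcI hj).resolve_left ?_
        rintro rfl
        exact Finsupp.mem_support_iff.1 hj h0
      refine ⟨-z (f r) • fun s => z (g s), ?_⟩
      rw [Matrix.mulVec_smul, hkey z hz hcI, neg_smul, smul_neg, neg_neg, smul_smul,
        Int.mul_self_eq_one_of_abs_le_one (hz1 _) hzr, one_smul]
    choose Y hY using hsolve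
    refine Matrix.isUnit_det_of_right_inverse (B := Matrix.of fun s r => Y r s) ?_
    ext i r
    have := congrFun (hY r) i
    rw [Matrix.one_apply, Matrix.mul_apply]
    simpa [Matrix.mulVec, dotProduct, Pi.single_apply] using this
  · obtain ⟨h1, h2⟩ := Matrix.vectorMatroid_isRepresentedBy_int haA
    refine Matroid.ext_indep rfl fun I hI => ?_
    have hI' : I ⊆ M.E := hI
    rw [h2 I hI, hind I hI']
    exact ⟨fun H z hz hzI => H z ((hrel z (hzI.trans hI')).2 hz) hzI,
      fun H z hz hzI => H z ((hrel z (hzI.trans hI')).1 hz) hzI⟩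

/-! ### The cycle space of a standard representation and of a 3-sum. -/

namespace StandardRepr

open scoped Classical in
/-- The matrix `[1 | B]`, extended by zero to all indices. -/
noncomputable def extend {α : Type*} (S : StandardRepr α (ZMod 2)) : Matrix S.X α (ZMod 2) :=
  fun i j => (if j = i then 1 else 0) + S.entry i j

/-- The binary relations between the columns of `[1 | B]`. -/
noncomputable def cycles {α : Type*} (S : StandardRepr α (ZMod 2)) :
    Submodule (ZMod 2) (α →₀ ZMod 2) :=
  relations (S.X ∪ S.Y) S.extend

theorem entry_of_notMem_right {α : Type*} (S : StandardRepr α (ZMod 2)) {i j : α} (hj : j ∉ S.Y) :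
    S.entry i j = 0 :=
  dif_neg fun h => hj h.2

theorem toMatroid_isRepresentedBy {α : Type*} (S : StandardRepr α (ZMod 2)) :
    S.toMatroid.IsRepresentedBy S.cycles := by
  classical
  refine Matrix.vectorMatroid_isRepresentedBy fun i j => ?_
  obtain ⟨j, hj | hj⟩ := j
  · have hjY : j ∉ S.Y := S.disjoint.notMem_of_mem_left hj
    simp only [extend, entry_of_notMem_right S hjY, add_zero, toFull, Matrix.submatrix_apply, id]
    rw [Equiv.Set.union_apply_left (a := ⟨j, Or.inl hj⟩) S.disjoint hj, Matrix.fromCols_apply_inl,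
      Matrix.one_apply]
    simp [Subtype.ext_iff, eq_comm]
  · have hjX : j ∉ S.X := S.disjoint.notMem_of_mem_right hj
    simp only [extend, toFull, Matrix.submatrix_apply, id]
    rw [Equiv.Set.union_apply_right (a := ⟨j, Or.inr hj⟩) S.disjoint hj, Matrix.fromCols_apply_inr,
      if_neg (fun h : j = i => hjX (h ▸ i.2)), zero_add, entry, dif_pos ⟨i.2, hj⟩]

theorem mem_cycles_iff {α : Type*} (S : StandardRepr α (ZMod 2)) {c : α →₀ ZMod 2} {F : Finset α}
    (hF : c.support ⊆ F) :
    c ∈ S.cycles ↔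
      (c.support : Set α) ⊆ S.X ∪ S.Y ∧ ∀ i ∈ S.X, c i = ∑ j ∈ F, S.entry i j * c j := by
  classical
  rw [cycles, mem_relations]
  have key : ∀ i : S.X,
      ∑ j ∈ c.support, S.extend i j * c j = c i - ∑ j ∈ F, S.entry i j * c j := by
    intro i
    rw [Finset.sum_subset hF fun j _ hj => by rw [Finsupp.notMem_support_iff.1 hj, mul_zero],
      CharTwo.sub_eq_add]
    simp only [extend, add_mul, Finset.sum_add_distrib, ite_mul, one_mul, zero_mul]
    rw [Finset.sum_ite_eq']
    congr 1
    split_ifs with hi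
    · rfl
    · exact (Finsupp.notMem_support_iff.1 fun h => hi (hF h)).symm
  simp only [key, sub_eq_zero, Subtype.forall]

theorem eq_sum_of_mem_cycles {α : Type*} {S : StandardRepr α (ZMod 2)} {c : α →₀ ZMod 2}
    (hc : c ∈ S.cycles) {F : Finset α} (hF : c.support ⊆ F) {i : α} (hi : i ∈ S.X) :
    c i = ∑ j ∈ F, S.entry i j * c j :=
  ((S.mem_cycles_iff hF).1 hc).2 i hi

theorem notMem_support_of_notMem {α : Type*} {S : StandardRepr α (ZMod 2)} {c : α →₀ ZMod 2}
    (hc : c ∈ S.cycles) {j : α} (hX : j ∉ S.X) (hY : j ∉ S.Y) : c j = 0 :=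
  Finsupp.notMem_support_iff.1 fun h => ((mem_relations.1 hc).1 h).elim hX hY

/-- The elements of the left summand that are not shared with the triangle `x₁, x₀, y₂`. -/
def leftPart {α : Type*} (Sₗ : StandardRepr α (ZMod 2)) (x₀ x₁ y₂ : α) : Set α :=
  (Sₗ.X \ {x₁, x₀}) ∪ (Sₗ.Y \ {y₂})

/-- The elements of the right summand that are not shared with the triad `x₂, y₀, y₁`. -/
def rightPart {α : Type*} (Sᵣ : StandardRepr α (ZMod 2)) (x₂ y₀ y₁ : α) : Set α :=
  (Sᵣ.X \ {x₂}) ∪ (Sᵣ.Y \ {y₀, y₁})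

namespace IsSum3

variable {α : Type*} {S Sₗ Sᵣ : StandardRepr α (ZMod 2)} {x₀ x₁ x₂ y₀ y₁ y₂ : α}
  {D₀ : Matrix (Fin 2) (Fin 2) (ZMod 2)}

theorem x₀_mem (h : S.IsSum3 Sₗ Sᵣ x₀ x₁ x₂ y₀ y₁ y₂ D₀) : x₀ ∈ Sₗ.X ∩ Sᵣ.X := by
  simp [h.inter_X]

theorem x₁_mem (h : S.IsSum3 Sₗ Sᵣ x₀ x₁ x₂ y₀ y₁ y₂ D₀) : x₁ ∈ Sₗ.X ∩ Sᵣ.X := by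
  simp [h.inter_X]

theorem x₂_mem (h : S.IsSum3 Sₗ Sᵣ x₀ x₁ x₂ y₀ y₁ y₂ D₀) : x₂ ∈ Sₗ.X ∩ Sᵣ.X := by
  simp [h.inter_X]

theorem y₀_mem (h : S.IsSum3 Sₗ Sᵣ x₀ x₁ x₂ y₀ y₁ y₂ D₀) : y₀ ∈ Sₗ.Y ∩ Sᵣ.Y := by
  simp [h.inter_Y]

theorem y₁_mem (h : S.IsSum3 Sₗ Sᵣ x₀ x₁ x₂ y₀ y₁ y₂ D₀) : y₁ ∈ Sₗ.Y ∩ Sᵣ.Y := by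
  simp [h.inter_Y]

theorem y₂_mem (h : S.IsSum3 Sₗ Sᵣ x₀ x₁ x₂ y₀ y₁ y₂ D₀) : y₂ ∈ Sₗ.Y ∩ Sᵣ.Y := by
  simp [h.inter_Y]

theorem notMem_Y (h : S.IsSum3 Sₗ Sᵣ x₀ x₁ x₂ y₀ y₁ y₂ D₀) {j : α} (hj : j ∈ Sₗ.X ∪ Sᵣ.X) :
    j ∉ Sₗ.Y ∧ j ∉ Sᵣ.Y := by
  rcases hj with hj | hj
  · exact ⟨Sₗ.disjoint.notMem_of_mem_left hj, h.disjoint_Xₗ_Yᵣ.notMem_of_mem_left hj⟩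
  · exact ⟨h.disjoint_Yₗ_Xᵣ.notMem_of_mem_right hj, Sᵣ.disjoint.notMem_of_mem_left hj⟩

theorem notMem_X (h : S.IsSum3 Sₗ Sᵣ x₀ x₁ x₂ y₀ y₁ y₂ D₀) {j : α} (hj : j ∈ Sₗ.Y ∪ Sᵣ.Y) :
    j ∉ Sₗ.X ∧ j ∉ Sᵣ.X := by
  rcases hj with hj | hj
  · exact ⟨Sₗ.disjoint.notMem_of_mem_right hj, h.disjoint_Yₗ_Xᵣ.notMem_of_mem_left hj⟩
  · exact ⟨h.disjoint_Xₗ_Yᵣ.notMem_of_mem_right hj, Sᵣ.disjoint.notMem_of_mem_right hj⟩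

theorem eq_of_mem_inter_X (h : S.IsSum3 Sₗ Sᵣ x₀ x₁ x₂ y₀ y₁ y₂ D₀) {i : α} (hl : i ∈ Sₗ.X)
    (hr : i ∈ Sᵣ.X) : i = x₂ ∨ i = x₁ ∨ i = x₀ := by
  have := h.inter_X.subset ⟨hl, hr⟩
  simpa using this

theorem eq_of_mem_inter_Y (h : S.IsSum3 Sₗ Sᵣ x₀ x₁ x₂ y₀ y₁ y₂ D₀) {j : α} (hl : j ∈ Sₗ.Y)
    (hr : j ∈ Sᵣ.Y) : j = y₀ ∨ j = y₁ ∨ j = y₂ := by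
  have := h.inter_Y.subset ⟨hl, hr⟩
  simpa using this

theorem det_D₀ (h : S.IsSum3 Sₗ Sᵣ x₀ x₁ x₂ y₀ y₁ y₂ D₀) :
    D₀ 0 0 * D₀ 1 1 - D₀ 0 1 * D₀ 1 0 = 1 := by
  rw [← Matrix.det_fin_two]
  exact ZMod.two_eq_one_of_ne_zero ((Matrix.isUnit_iff_isUnit_det _).1 h.isUnit_D₀).ne_zero

theorem inv_D₀ (h : S.IsSum3 Sₗ Sᵣ x₀ x₁ x₂ y₀ y₁ y₂ D₀) :
    D₀⁻¹ = !![D₀ 1 1, D₀ 0 1; D₀ 1 0, D₀ 0 0] := by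
  rw [Matrix.inv_def, Matrix.det_fin_two, h.det_D₀, Matrix.adjugate_fin_two]
  simp [CharTwo.neg_eq]

theorem left_entries (h : S.IsSum3 Sₗ Sᵣ x₀ x₁ x₂ y₀ y₁ y₂ D₀) :
    Sₗ.entry x₁ y₀ = D₀ 0 0 ∧ Sₗ.entry x₁ y₁ = D₀ 0 1 ∧ Sₗ.entry x₀ y₀ = D₀ 1 0 ∧
      Sₗ.entry x₀ y₁ = D₀ 1 1 := by
  rw [← h.D₀_left]
  simp

theorem right_entries (h : S.IsSum3 Sₗ Sᵣ x₀ x₁ x₂ y₀ y₁ y₂ D₀) :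
    Sᵣ.entry x₁ y₀ = D₀ 0 0 ∧ Sᵣ.entry x₁ y₁ = D₀ 0 1 ∧ Sᵣ.entry x₀ y₀ = D₀ 1 0 ∧
      Sᵣ.entry x₀ y₁ = D₀ 1 1 := by
  rw [← h.D₀_right]
  simp

theorem sum_entries (h : S.IsSum3 Sₗ Sᵣ x₀ x₁ x₂ y₀ y₁ y₂ D₀) :
    S.entry x₁ y₀ = D₀ 0 0 ∧ S.entry x₁ y₁ = D₀ 0 1 ∧ S.entry x₀ y₀ = D₀ 1 0 ∧
      S.entry x₀ y₁ = D₀ 1 1 := by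
  rw [← h.sum_D₀]
  simp

/-- The whole lower left block of the sum is the product of the columns `y₀, y₁` of `Sᵣ`, the
inverse of `D₀`, and the rows `x₁, x₀` of `Sₗ`. -/
theorem entry_eq (h : S.IsSum3 Sₗ Sᵣ x₀ x₁ x₂ y₀ y₁ y₂ D₀) {i j : α} (hi : i ∈ Sᵣ.X \ {x₂})
    (hj : j ∈ Sₗ.Y \ {y₂}) :
    S.entry i j =
      Sᵣ.entry i y₀ * (D₀ 1 1 * Sₗ.entry x₁ j + D₀ 0 1 * Sₗ.entry x₀ j) +
        Sᵣ.entry i y₁ * (D₀ 1 0 * Sₗ.entry x₁ j + D₀ 0 0 * Sₗ.entry x₀ j) := by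
  have hdet := h.det_D₀
  obtain ⟨l1, l2, l3, l4⟩ := h.left_entries
  obtain ⟨r1, r2, r3, r4⟩ := h.right_entries
  obtain ⟨s1, s2, s3, s4⟩ := h.sum_entries
  have hl := h.sum_Dₗ
  by_cases hj' : j = y₀ ∨ j = y₁
  · have hS : S.entry i j = Sᵣ.entry i j := by
      by_cases hi' : i = x₁ ∨ i = x₀
      · rcases hi' with rfl | rfl <;> rcases hj' with rfl | rfl <;> simp [*]
      · exact h.sum_Dᵣ i ⟨hi.1, by simpa using ⟨hi.2, not_or.1 hi'⟩⟩ j (by simpa using hj')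
    rw [hS]
    rcases hj' with rfl | rfl
    · rw [l1, l3]
      grind
    · rw [l2, l4]
      grind
  · have hjY : j ∈ Sₗ.Y \ {y₀, y₁, y₂} := ⟨hj.1, by
      have := hj.2
      simp only [mem_insert_iff, mem_singleton_iff] at this ⊢
      tauto⟩
    by_cases hi' : i = x₁ ∨ i = x₀
    · rw [h.sum_Dₗ i (by simpa using hi') j hjY]
      rcases hi' with rfl | rfl
      · rw [r1, r2]
        grind
      · rw [r3, r4]
        grind
    · rw [h.sum_Dₗᵣ i ⟨hi.1, by simpa using ⟨hi.2, not_or.1 hi'⟩⟩ j hjY, h.inv_D₀]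
      simp [Matrix.mulVec, dotProduct, Fin.sum_univ_two]

/-- On these rows S and Sₗ agree off the column y₂, where Sₗ vanishes, and S vanishes on the columns
coming only from the right. -/
theorem sum_entry_left (h : S.IsSum3 Sₗ Sᵣ x₀ x₁ x₂ y₀ y₁ y₂ D₀) {i : α}
    (hi : i ∈ Sₗ.X \ {x₁, x₀}) {c a : α → ZMod 2} (hca : ∀ j ∈ Sₗ.Y \ {y₂}, c j = a j)
    (F : Finset α) : ∑ j ∈ F, S.entry i j * c j = ∑ j ∈ F, Sₗ.entry i j * a j := by
  refine Finset.sum_congr rfl fun j _ => ?_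
  by_cases hjl : j ∈ Sₗ.Y \ {y₂}
  · rw [h.sum_Aₗ i hi j hjl, hca j hjl]
  have hl : Sₗ.entry i j = 0 := by
    by_cases hj : j ∈ Sₗ.Y
    · obtain rfl : j = y₂ := by
        by_contra hne
        exact hjl ⟨hj, hne⟩
      exact h.left_zero i hi
    · exact Sₗ.entry_of_notMem_right hj
  have hs : S.entry i j = 0 := by
    by_cases hjr : j ∈ Sᵣ.Y \ {y₀, y₁}
    · exact h.sum_zero i hi j hjr
    · refine S.entry_of_notMem_right ?_
      rw [h.Y_eq]
      rintro (hj | hj)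
      · obtain rfl : j = y₂ := by
          by_contra hne
          exact hjl ⟨hj, hne⟩
        exact hjr ⟨h.y₂_mem.2, by simp [h.y₀_ne_y₂.symm, h.y₁_ne_y₂.symm]⟩
      · have : j = y₀ ∨ j = y₁ := by
          by_contra hne
          exact hjr ⟨hj, by simpa using hne⟩
        rcases this with rfl | rfl
        · exact hjl ⟨h.y₀_mem.1, h.y₀_ne_y₂⟩
        · exact hjl ⟨h.y₁_mem.1, h.y₁_ne_y₂⟩
  rw [hl, hs, zero_mul, zero_mul]

/-- By `entry_eq`, row i of the lower left block is (p, q) D₀⁻¹ applied to rows x₁, x₀ of Sₗ. The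
left equations turn its contribution into (p, q) D₀⁻¹ applied to (a x₁ + a y₂, a x₀ + a y₂), which
compatibility makes p b y₀ + q b y₁, the missing part of the right-hand sum. -/
theorem sum_entry_right (h : S.IsSum3 Sₗ Sᵣ x₀ x₁ x₂ y₀ y₁ y₂ D₀) {i : α}
    (hi : i ∈ Sᵣ.X \ {x₂}) {c a b : α → ZMod 2} (hca : ∀ j ∈ Sₗ.Y \ {y₂}, c j = a j)
    (hcb : ∀ j ∈ Sᵣ.Y \ {y₀, y₁}, c j = b j)
    (h₁ : a x₁ + a y₂ = D₀ 0 0 * b y₀ + D₀ 0 1 * b y₁)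
    (h₀ : a x₀ + a y₂ = D₀ 1 0 * b y₀ + D₀ 1 1 * b y₁)
    {F : Finset α} (hy₀ : y₀ ∈ F) (hy₁ : y₁ ∈ F) (hy₂ : y₂ ∈ F)
    (ha₁ : a x₁ = ∑ j ∈ F, Sₗ.entry x₁ j * a j) (ha₀ : a x₀ = ∑ j ∈ F, Sₗ.entry x₀ j * a j) :
    ∑ j ∈ F, S.entry i j * c j = ∑ j ∈ F, Sᵣ.entry i j * b j := by
  classical
  have hdet := h.det_D₀
  set p := Sᵣ.entry i y₀ with hp
  set q := Sᵣ.entry i y₁ with hq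
  have key : ∀ j, S.entry i j * c j =
      (p * D₀ 1 1 + q * D₀ 1 0) * (Sₗ.entry x₁ j * a j) +
      (p * D₀ 0 1 + q * D₀ 0 0) * (Sₗ.entry x₀ j * a j) + Sᵣ.entry i j * b j -
      (if j = y₂ then (p * D₀ 1 1 + q * D₀ 1 0 + p * D₀ 0 1 + q * D₀ 0 0) * a y₂ else 0) -
      (if j = y₀ then p * b y₀ else 0) - (if j = y₁ then q * b y₁ else 0) := by
    intro j
    by_cases hjl : j ∈ Sₗ.Y \ {y₂}
    · have hne : j ≠ y₂ := hjl.2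
      rw [h.entry_eq hi hjl, hca j hjl, if_neg hne, ← hp, ← hq]
      have hr : Sᵣ.entry i j * b j =
          (if j = y₀ then p * b y₀ else 0) + (if j = y₁ then q * b y₁ else 0) := by
        by_cases hj₀ : j = y₀
        · subst hj₀
          simp [h.y₀_ne_y₁, hp]
        by_cases hj₁ : j = y₁
        · subst hj₁
          simp [h.y₀_ne_y₁.symm, hq]
        rw [if_neg hj₀, if_neg hj₁, Sᵣ.entry_of_notMem_right, zero_mul, add_zero]
        intro hjr
        rcases h.eq_of_mem_inter_Y hjl.1 hjr with h | h | h <;> contradiction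
      rw [hr]
      ring
    by_cases hj₂ : j = y₂
    · subst hj₂
      have hjr : j ∈ Sᵣ.Y \ {y₀, y₁} :=
        ⟨h.y₂_mem.2, by simp [h.y₀_ne_y₂.symm, h.y₁_ne_y₂.symm]⟩
      rw [h.sum_Aᵣ i hi j hjr, hcb j hjr, h.left_x₁_y₂, h.left_x₀_y₂, if_pos rfl,
        if_neg h.y₀_ne_y₂.symm, if_neg h.y₁_ne_y₂.symm]
      ring
    have hjl' : j ∉ Sₗ.Y := fun hj => hjl ⟨hj, hj₂⟩
    have hj₀ : j ≠ y₀ := fun h' => hjl' (h' ▸ h.y₀_mem.1)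
    have hj₁ : j ≠ y₁ := fun h' => hjl' (h' ▸ h.y₁_mem.1)
    rw [Sₗ.entry_of_notMem_right hjl', Sₗ.entry_of_notMem_right hjl', if_neg hj₂, if_neg hj₀,
      if_neg hj₁]
    by_cases hjr : j ∈ Sᵣ.Y
    · have hjr' : j ∈ Sᵣ.Y \ {y₀, y₁} := ⟨hjr, by simp [hj₀, hj₁]⟩
      rw [h.sum_Aᵣ i hi j hjr', hcb j hjr']
      ring
    · rw [Sᵣ.entry_of_notMem_right hjr, S.entry_of_notMem_right (by simp [h.Y_eq, hjl', hjr])]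
      ring
  simp only [key, Finset.sum_sub_distrib, Finset.sum_add_distrib, ← Finset.mul_sum, ← ha₁, ← ha₀,
    Finset.sum_ite_eq', hy₀, hy₁, hy₂, if_true]
  grind

theorem y₀_mem_leftPart (h : S.IsSum3 Sₗ Sᵣ x₀ x₁ x₂ y₀ y₁ y₂ D₀) :
    y₀ ∈ leftPart Sₗ x₀ x₁ y₂ :=
  Or.inr ⟨h.y₀_mem.1, h.y₀_ne_y₂⟩

theorem y₁_mem_leftPart (h : S.IsSum3 Sₗ Sᵣ x₀ x₁ x₂ y₀ y₁ y₂ D₀) :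
    y₁ ∈ leftPart Sₗ x₀ x₁ y₂ :=
  Or.inr ⟨h.y₁_mem.1, h.y₁_ne_y₂⟩

theorem x₂_mem_leftPart (h : S.IsSum3 Sₗ Sᵣ x₀ x₁ x₂ y₀ y₁ y₂ D₀) :
    x₂ ∈ leftPart Sₗ x₀ x₁ y₂ :=
  Or.inl ⟨h.x₂_mem.1, by simp [h.x₁_ne_x₂.symm, h.x₀_ne_x₂.symm]⟩

/-- Each of the six shared elements is dropped on exactly one side: x₁, x₀, y₂ on the left and x₂,
y₀, y₁ on the right. -/
theorem disjoint_parts (h : S.IsSum3 Sₗ Sᵣ x₀ x₁ x₂ y₀ y₁ y₂ D₀) {j : α}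
    (hl : j ∈ leftPart Sₗ x₀ x₁ y₂) : j ∉ rightPart Sᵣ x₂ y₀ y₁ := by
  rcases hl with ⟨hl, hl'⟩ | ⟨hl, hl'⟩ <;> rintro (⟨hr, hr'⟩ | ⟨hr, hr'⟩)
  · rcases h.eq_of_mem_inter_X hl hr with h | h | h <;> simp [h] at hl' hr'
  · exact (h.notMem_Y (Or.inl hl)).2 hr
  · exact (h.notMem_X (Or.inl hl)).2 hr
  · rcases h.eq_of_mem_inter_Y hl hr with h | h | h <;> simp [h] at hl' hr'

theorem parts_union (h : S.IsSum3 Sₗ Sᵣ x₀ x₁ x₂ y₀ y₁ y₂ D₀) :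
    leftPart Sₗ x₀ x₁ y₂ ∪ rightPart Sᵣ x₂ y₀ y₁ = S.X ∪ S.Y := by
  rw [h.X_eq, h.Y_eq]
  have h1 := h.x₀_mem
  have h2 := h.x₁_mem
  have h3 := h.x₂_mem
  have h4 := h.y₀_mem
  have h5 := h.y₁_mem
  have h6 := h.y₂_mem
  have := h.x₀_ne_x₂
  have := h.x₁_ne_x₂
  have := h.y₀_ne_y₂
  have := h.y₁_ne_y₂
  ext j
  simp only [leftPart, rightPart, mem_union, mem_sdiff, mem_insert_iff, mem_singleton_iff]
  grind

/-- Compatible members of the cycle spaces of the summands glue to a member of the cycle space of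
the sum. -/
theorem mem_cycles_of_compatible (h : S.IsSum3 Sₗ Sᵣ x₀ x₁ x₂ y₀ y₁ y₂ D₀)
    {a b c : α →₀ ZMod 2} (ha : a ∈ Sₗ.cycles) (hb : b ∈ Sᵣ.cycles)
    (hc : (c.support : Set α) ⊆ leftPart Sₗ x₀ x₁ y₂ ∪ rightPart Sᵣ x₂ y₀ y₁)
    (hca : ∀ j ∈ leftPart Sₗ x₀ x₁ y₂, c j = a j) (hcb : ∀ j ∈ rightPart Sᵣ x₂ y₀ y₁, c j = b j)
    (h₁ : a x₁ + a y₂ = D₀ 0 0 * b y₀ + D₀ 0 1 * b y₁)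
    (h₀ : a x₀ + a y₂ = D₀ 1 0 * b y₀ + D₀ 1 1 * b y₁) : c ∈ S.cycles := by
  classical
  let F := c.support ∪ a.support ∪ b.support ∪ {y₀, y₁, y₂}
  have hFc : c.support ⊆ F := by intro j; simp [F]; tauto
  have hFa : a.support ⊆ F := by intro j; simp [F]; tauto
  have hFb : b.support ⊆ F := by intro j; simp [F]; tauto
  rw [S.mem_cycles_iff hFc]
  refine ⟨h.parts_union ▸ hc, fun i hi => ?_⟩
  by_cases hir : i ∈ Sᵣ.X \ {x₂}
  · rw [hcb i (Or.inl hir), eq_sum_of_mem_cycles hb hFb hir.1]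
    exact (h.sum_entry_right hir (fun j hj => hca j (Or.inr hj)) (fun j hj => hcb j (Or.inr hj))
      h₁ h₀ (by simp [F]) (by simp [F]) (by simp [F]) (eq_sum_of_mem_cycles ha hFa h.x₁_mem.1)
      (eq_sum_of_mem_cycles ha hFa h.x₀_mem.1)).symm
  · have hil : i ∈ Sₗ.X \ {x₁, x₀} := by
      have h1 := h.x₀_mem
      have h2 := h.x₁_mem
      have h3 := h.x₂_mem
      have := h.x₀_ne_x₂
      have := h.x₁_ne_x₂
      rw [h.X_eq] at hi
      simp only [mem_union, mem_sdiff, mem_insert_iff, mem_singleton_iff] at hi hir ⊢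
      grind
    rw [hca i (Or.inl hil), eq_sum_of_mem_cycles ha hFa hil.1]
    exact (h.sum_entry_left hil (fun j hj => hca j (Or.inr hj)) F).symm

/-- Every member of the cycle space of the sum arises by gluing. -/
theorem exists_compatible (h : S.IsSum3 Sₗ Sᵣ x₀ x₁ x₂ y₀ y₁ y₂ D₀)
    {c : α →₀ ZMod 2} (hc : c ∈ S.cycles) :
    ∃ a ∈ Sₗ.cycles, ∃ b ∈ Sᵣ.cycles,
      (∀ j ∈ leftPart Sₗ x₀ x₁ y₂, c j = a j) ∧ (∀ j ∈ rightPart Sᵣ x₂ y₀ y₁, c j = b j) ∧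
      a x₁ + a y₂ = D₀ 0 0 * b y₀ + D₀ 0 1 * b y₁ ∧
      a x₀ + a y₂ = D₀ 1 0 * b y₀ + D₀ 1 1 * b y₁ ∧
      (a y₂ = 0 ∧ a x₁ * a x₀ = 0 ∨ a x₁ = 0 ∧ a x₀ = 0) := by
  classical
  have hdet := h.det_D₀
  have n1 : x₀ ∉ leftPart Sₗ x₀ x₁ y₂ := by
    simp [leftPart, (h.notMem_Y (Or.inl h.x₀_mem.1)).1]
  have n2 : x₁ ∉ leftPart Sₗ x₀ x₁ y₂ := by
    simp [leftPart, (h.notMem_Y (Or.inl h.x₁_mem.1)).1]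
  have n3 : y₂ ∉ leftPart Sₗ x₀ x₁ y₂ := by
    simp [leftPart, (h.notMem_X (Or.inl h.y₂_mem.1)).1]
  have m1 := h.disjoint_parts h.y₀_mem_leftPart
  have m2 := h.disjoint_parts h.y₁_mem_leftPart
  have m3 := h.disjoint_parts h.x₂_mem_leftPart
  have ex := h.x₀_ne_x₁
  have hX := h.notMem_X (Or.inl h.y₂_mem.1)
  have hx1y : x₁ ≠ y₂ := fun e => hX.1 (e ▸ h.x₁_mem.1)
  have hx0y : x₀ ≠ y₂ := fun e => hX.1 (e ▸ h.x₀_mem.1)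
  have hX0 := h.notMem_X (Or.inl h.y₀_mem.1)
  have hX1 := h.notMem_X (Or.inl h.y₁_mem.1)
  have hy0x : y₀ ≠ x₂ := fun e => hX0.1 (e ▸ h.x₂_mem.1)
  have hy1x : y₁ ≠ x₂ := fun e => hX1.1 (e ▸ h.x₂_mem.1)
  let F := c.support ∪ {x₀, x₁, x₂, y₀, y₁, y₂}
  have hFc : c.support ⊆ F := by intro j; simp [F]; tauto
  -- The left row sums without the column y₂, whose entry t is still free. Changing t adds the
  -- triangle {x₁, x₀, y₂} to a, so t can be chosen to leave at most one nonzero entry there; this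
  -- is what later makes the integral linking pair triangular.
  let q : α → ZMod 2 := fun i => ∑ j ∈ F, if j = y₂ then 0 else Sₗ.entry i j * c j
  obtain ⟨t, ht⟩ : ∃ t : ZMod 2,
      t = 0 ∧ (q x₁ + t) * (q x₀ + t) = 0 ∨ q x₁ + t = 0 ∧ q x₀ + t = 0 := by
    generalize q x₁ = u
    generalize q x₀ = v
    revert u v
    decide
  let a' : α → ZMod 2 := fun j =>
    if j = x₁ then q x₁ + t else if j = x₀ then q x₀ + t else if j = y₂ then t
    else if j ∈ leftPart Sₗ x₀ x₁ y₂ then c j else 0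
  -- The entries at y₀, y₁ are D₀⁻¹ applied to (q x₁, q x₀), and row x₂ of Sᵣ forces the entry at x₂
  -- to be their sum.
  let b' : α → ZMod 2 := fun j =>
    if j = y₀ then D₀ 1 1 * q x₁ + D₀ 0 1 * q x₀ else if j = y₁ then D₀ 1 0 * q x₁ + D₀ 0 0 * q x₀
    else if j = x₂ then D₀ 1 1 * q x₁ + D₀ 0 1 * q x₀ + (D₀ 1 0 * q x₁ + D₀ 0 0 * q x₀)
    else if j ∈ rightPart Sᵣ x₂ y₀ y₁ then c j else 0
  have hca : ∀ j ∈ leftPart Sₗ x₀ x₁ y₂, c j = a' j := by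
    intro j hj
    simp only [a']
    rw [if_neg, if_neg, if_neg, if_pos hj] <;> rintro rfl <;> contradiction
  have hcb : ∀ j ∈ rightPart Sᵣ x₂ y₀ y₁, c j = b' j := by
    intro j hj
    simp only [b']
    rw [if_neg, if_neg, if_neg, if_pos hj] <;> rintro rfl <;> contradiction
  have a1 : a' x₁ = q x₁ + t := by simp [a']
  have a0 : a' x₀ = q x₀ + t := by simp [a', ex]
  have a2 : a' y₂ = t := by simp [a', hx1y.symm, hx0y.symm]
  have b0 : b' y₀ = D₀ 1 1 * q x₁ + D₀ 0 1 * q x₀ := by simp [b']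
  have b1 : b' y₁ = D₀ 1 0 * q x₁ + D₀ 0 0 * q x₀ := by simp [b', h.y₀_ne_y₁.symm]
  have b2 : b' x₂ = b' y₀ + b' y₁ := by
    rw [b0, b1]
    simp [b', hy0x.symm, hy1x.symm]
  have hF : ∀ j ∉ F, c j = 0 := fun j hj => Finsupp.notMem_support_iff.1 fun hj' => hj (hFc hj')
  let a : α →₀ ZMod 2 := Finsupp.onFinset F a' fun j hj => by
    by_contra hjF
    refine hj ?_
    simp only [F, Finset.mem_union, Finset.mem_insert, Finset.mem_singleton, not_or] at hjF
    simp only [a']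
    rw [if_neg (by tauto), if_neg (by tauto), if_neg (by tauto)]
    simp [Finsupp.notMem_support_iff.1 hjF.1]
  let b : α →₀ ZMod 2 := Finsupp.onFinset F b' fun j hj => by
    by_contra hjF
    refine hj ?_
    simp only [F, Finset.mem_union, Finset.mem_insert, Finset.mem_singleton, not_or] at hjF
    simp only [b']
    rw [if_neg (by tauto), if_neg (by tauto), if_neg (by tauto)]
    simp [Finsupp.notMem_support_iff.1 hjF.1]
  have hFa : a.support ⊆ F := Finsupp.support_onFinset_subset
  have hFb : b.support ⊆ F := Finsupp.support_onFinset_subset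
  have h₁ : a' x₁ + a' y₂ = D₀ 0 0 * b' y₀ + D₀ 0 1 * b' y₁ := by
    rw [a1, a2, b0, b1]
    grind
  have h₀ : a' x₀ + a' y₂ = D₀ 1 0 * b' y₀ + D₀ 1 1 * b' y₁ := by
    rw [a0, a2, b0, b1]
    grind
  have hq : ∀ i, Sₗ.entry i y₂ = 1 → q i + t = ∑ j ∈ F, Sₗ.entry i j * a' j := by
    intro i hi
    have : ∀ j, Sₗ.entry i j * a' j =
        (if j = y₂ then 0 else Sₗ.entry i j * c j) + if j = y₂ then t else 0 := by
      intro j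
      by_cases hj : j = y₂
      · subst hj
        rw [hi, a2]
        simp
      · rw [if_neg hj, if_neg hj, add_zero]
        by_cases hjY : j ∈ Sₗ.Y
        · rw [hca j (Or.inr ⟨hjY, hj⟩)]
        · rw [Sₗ.entry_of_notMem_right hjY, zero_mul, zero_mul]
    simp only [this, Finset.sum_add_distrib, Finset.sum_ite_eq']
    rw [if_pos (by simp [F])]
  have hSc : ∀ i ∈ S.X, c i = ∑ j ∈ F, S.entry i j * c j :=
    fun i hi => eq_sum_of_mem_cycles hc hFc hi
  have ha1 : a' x₁ = ∑ j ∈ F, Sₗ.entry x₁ j * a' j := by rw [a1, hq _ h.left_x₁_y₂]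
  have ha0 : a' x₀ = ∑ j ∈ F, Sₗ.entry x₀ j * a' j := by rw [a0, hq _ h.left_x₀_y₂]
  refine ⟨a, (Sₗ.mem_cycles_iff hFa).2 ⟨?_, fun i hi => ?_⟩, b,
    (Sᵣ.mem_cycles_iff hFb).2 ⟨?_, fun i hi => ?_⟩, hca, hcb, h₁, h₀, ?_⟩
  · intro j hj
    have hj' : a' j ≠ 0 := Finsupp.mem_support_iff.1 hj
    simp only [a'] at hj'
    split_ifs at hj' with e1 e2 e3 e4
    · exact Or.inl (e1 ▸ h.x₁_mem.1)
    · exact Or.inl (e2 ▸ h.x₀_mem.1)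
    · exact Or.inr (e3 ▸ h.y₂_mem.1)
    · exact e4.imp And.left And.left
    · exact absurd rfl hj'
  · change a' i = ∑ j ∈ F, Sₗ.entry i j * a' j
    by_cases hi' : i ∈ Sₗ.X \ {x₁, x₀}
    · rw [← hca i (Or.inl hi'), hSc i (h.X_eq ▸ Or.inl hi)]
      exact h.sum_entry_left hi' (fun j hj => hca j (Or.inr hj)) F
    · have : i = x₁ ∨ i = x₀ := by
        by_contra hne
        exact hi' ⟨hi, by simpa using hne⟩
      rcases this with rfl | rfl
      · exact ha1
      · exact ha0
  · intro j hj
    have hj' : b' j ≠ 0 := Finsupp.mem_support_iff.1 hj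
    simp only [b'] at hj'
    split_ifs at hj' with e1 e2 e3 e4
    · exact Or.inr (e1 ▸ h.y₀_mem.2)
    · exact Or.inr (e2 ▸ h.y₁_mem.2)
    · exact Or.inl (e3 ▸ h.x₂_mem.2)
    · exact e4.imp And.left And.left
    · exact absurd rfl hj'
  · change b' i = ∑ j ∈ F, Sᵣ.entry i j * b' j
    by_cases hi' : i = x₂
    · subst hi'
      have : ∀ j, Sᵣ.entry i j * b' j =
          (if j = y₀ then b' y₀ else 0) + if j = y₁ then b' y₁ else 0 := by
        intro j
        by_cases e0 : j = y₀
        · subst e0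
          simp [h.right_x₂_y₀, h.y₀_ne_y₁]
        by_cases e1 : j = y₁
        · subst e1
          simp [h.right_x₂_y₁, h.y₀_ne_y₁.symm]
        rw [if_neg e0, if_neg e1, add_zero]
        by_cases hjY : j ∈ Sᵣ.Y
        · rw [h.right_zero j ⟨hjY, by simp [e0, e1]⟩, zero_mul]
        · rw [Sᵣ.entry_of_notMem_right hjY, zero_mul]
      simp only [this, Finset.sum_add_distrib, Finset.sum_ite_eq']
      rw [if_pos (by simp [F]), if_pos (by simp [F]), b2]
    · have hir : i ∈ Sᵣ.X \ {x₂} := ⟨hi, hi'⟩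
      rw [← hcb i (Or.inl hir), hSc i (h.X_eq ▸ Or.inr hi)]
      exact h.sum_entry_right hir (fun j hj => hca j (Or.inr hj)) (fun j hj => hcb j (Or.inr hj))
        h₁ h₀ (by simp [F]) (by simp [F]) (by simp [F]) ha1 ha0
  · change a' y₂ = 0 ∧ a' x₁ * a' x₀ = 0 ∨ a' x₁ = 0 ∧ a' x₀ = 0
    rw [a1, a0, a2]
    exact ht

end IsSum3

end StandardRepr

/-! ### Signs and integral linking conditions. -/

/-- If every binary cycle meets `{x, y, y'}` evenly, then the lifts avoiding `x` have entries at `y`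
and `y'` in a fixed proportion. -/
theorem IsUnimodularLift.exists_sign {α : Type*} {Λ : Submodule ℤ (α →₀ ℤ)}
    {C : Submodule (ZMod 2) (α →₀ ZMod 2)} (h : IsUnimodularLift Λ C) {x y y' : α}
    (heven : ∀ c ∈ C, c x = c y + c y') :
    ∃ γ : ℤ, γ * γ = 1 ∧ ∀ z ∈ Λ, z x = 0 → |z y| ≤ 1 → |z y'| ≤ 1 → z y ≠ 0 → z y' ≠ 0 →
      z y' = γ * z y := by
  by_contra! H
  obtain ⟨z, hz, hzx, hzy, hzy', hz0, hz0', hne⟩ := H 1 rfl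
  obtain ⟨w, hw, hwx, hwy, hwy', hw0, hw0', hne'⟩ := H (-1) rfl
  have hz' : z y * z y' = -1 := by
    have := abs_le.1 hzy
    have := abs_le.1 hzy'
    obtain e | e : z y = 1 ∨ z y = -1 := by omega
    all_goals rw [e] at hne ⊢; omega
  have hw' : w y * w y' = 1 := by
    have := abs_le.1 hwy
    have := abs_le.1 hwy'
    obtain e | e : w y = 1 ∨ w y = -1 := by omega
    all_goals rw [e] at hne' ⊢; omega
  -- The opposite proportions of z and w make u equal to 0, 2, 0 at x, y, y'. The {0, 1, -1} lift d
  -- of its reduction vanishes at all three, so (u - d) / 2 lies in Λ and is 0, 1, 0 there, against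
  -- evenness.
  let u := w y • w + z y • z
  have hu : u ∈ Λ := Λ.add_mem (Λ.smul_mem _ hw) (Λ.smul_mem _ hz)
  have hux : u x = 0 := by simp [u, hzx, hwx]
  have huy : u y = 2 := by
    simp [u, Int.mul_self_eq_one_of_abs_le_one hzy hz0, Int.mul_self_eq_one_of_abs_le_one hwy hw0]
  have huy' : u y' = 0 := by simp [u, hz', hw']
  obtain ⟨d, hd, hd1, hdu⟩ := h.exists_lift _ (h.modTwo_mem u hu)
  have hd0 : ∀ j, (u j : ZMod 2) = 0 → d j = 0 := fun j hj =>
    eq_zero_of_abs_le_one_of_cast_eq_zero (hd1 j) (by rw [← hj]; exact DFunLike.congr_fun hdu j)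
  obtain ⟨v, hv⟩ := (modTwo_eq_zero_iff (u - d)).1 (by
    ext j
    have := DFunLike.congr_fun hdu j
    simp only [modTwo_apply] at this
    simp [this])
  have hvΛ : v ∈ Λ := h.half_mem v (hv ▸ Λ.sub_mem hu hd)
  have hvj : ∀ j, u j - d j = 2 * v j := fun j => by simpa using DFunLike.congr_fun hv j
  have e1 := hvj x
  have e2 := hvj y
  have e3 := hvj y'
  rw [hd0 x (by simp [hux]), hux] at e1
  rw [hd0 y (by rw [huy]; rfl), huy] at e2
  rw [hd0 y' (by simp [huy']), huy'] at e3
  have := heven _ (h.modTwo_mem v hvΛ)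
  simp only [modTwo_apply] at this
  rw [show v x = 0 by omega, show v y = 1 by omega, show v y' = 0 by omega] at this
  simp at this

/-- Pairs representing, modulo `(1, 1, 1)`, zero or a signed unit vector of `ℤ³`. -/
def IsTriangular (m n : ℤ) : Prop :=
  |m| ≤ 1 ∧ |n| ≤ 1 ∧ |m - n| ≤ 1

/-- The nonzero triangular pairs are ±(1, 0), ±(0, 1), ±(1, 1), one antipodal pair for each nonzero
residue class. -/
theorem IsTriangular.eq_or_eq_neg {m n m' n' : ℤ} (h : IsTriangular m n) (h' : IsTriangular m' n')
    (hm : (m : ZMod 2) = m') (hn : (n : ZMod 2) = n') :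
    m = m' ∧ n = n' ∨ m = -m' ∧ n = -n' := by
  simp only [IsTriangular, abs_le] at h h'
  rw [← sub_eq_zero, ← Int.cast_sub, Int.cast_zmod_two_eq_zero_iff] at hm hn
  omega

/-- An invertible binary matrix of size two has an integral lift preserving triangular pairs. -/
theorem exists_triangular_lift {a b c d : ZMod 2} (h : a * d - b * c = 1) :
    ∃ a' b' c' d' : ℤ, (a' : ZMod 2) = a ∧ (b' : ZMod 2) = b ∧ (c' : ZMod 2) = c ∧
      (d' : ZMod 2) = d ∧
      ∀ m n, IsTriangular m n → IsTriangular (a' * m + b' * n) (c' * m + d' * n) := by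
  -- Six invertible matrices remain; the signs are chosen so that each lift permutes, up to sign,
  -- the three forms m, n, m - n.
  rcases ZMod.two_eq_zero_or_one a with rfl | rfl <;>
    rcases ZMod.two_eq_zero_or_one b with rfl | rfl <;>
    rcases ZMod.two_eq_zero_or_one c with rfl | rfl <;>
    rcases ZMod.two_eq_zero_or_one d with rfl | rfl <;> try (exact absurd h (by decide))
  · exact ⟨0, 1, 1, 0, by decide, by decide, by decide, by decide, fun m n => by
      simp only [IsTriangular, abs_le]; omega⟩
  · exact ⟨0, 1, -1, 1, by decide, by decide, by decide, by decide, fun m n => by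
      simp only [IsTriangular, abs_le]; omega⟩
  · exact ⟨1, 0, 0, 1, by decide, by decide, by decide, by decide, fun m n => by
      simp only [IsTriangular, abs_le]; omega⟩
  · exact ⟨-1, 0, -1, 1, by decide, by decide, by decide, by decide, fun m n => by
      simp only [IsTriangular, abs_le]; omega⟩
  · exact ⟨1, -1, 0, -1, by decide, by decide, by decide, by decide, fun m n => by
      simp only [IsTriangular, abs_le]; omega⟩
  · exact ⟨1, -1, 1, 0, by decide, by decide, by decide, by decide, fun m n => by
      simp only [IsTriangular, abs_le]; omega⟩

/-- The vectors on `L ∪ R` obtained by gluing members of two lattices whose restrictions to the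
linking elements satisfy two linear equations. -/
def gluedLattice {α : Type*} (Λₗ Λᵣ : Submodule ℤ (α →₀ ℤ)) (L R : Set α)
    (φ₁ φ₀ : (α →₀ ℤ) × (α →₀ ℤ) →ₗ[ℤ] ℤ) : Submodule ℤ (α →₀ ℤ) where
  carrier := {z | (z.support : Set α) ⊆ L ∪ R ∧ ∃ a ∈ Λₗ, ∃ b ∈ Λᵣ, (∀ j ∈ L, z j = a j) ∧
    (∀ j ∈ R, z j = b j) ∧ φ₁ (a, b) = 0 ∧ φ₀ (a, b) = 0}
  add_mem' := by
    classical
    rintro z z' ⟨hz, a, ha, b, hb, h1, h2, h3, h4⟩ ⟨hz', a', ha', b', hb', h1', h2', h3', h4'⟩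
    refine ⟨?_, a + a', Λₗ.add_mem ha ha', b + b', Λᵣ.add_mem hb hb', ?_, ?_, ?_, ?_⟩
    · refine (Finset.coe_subset.2 Finsupp.support_add).trans ?_
      rw [Finset.coe_union]
      exact union_subset hz hz'
    · intro j hj
      simp [h1 j hj, h1' j hj]
    · intro j hj
      simp [h2 j hj, h2' j hj]
    · rw [← Prod.mk_add_mk, map_add, h3, h3', add_zero]
    · rw [← Prod.mk_add_mk, map_add, h4, h4', add_zero]
  zero_mem' := ⟨by simp, 0, Λₗ.zero_mem, 0, Λᵣ.zero_mem, by simp, by simp, map_zero φ₁, map_zero φ₀⟩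
  smul_mem' := by
    rintro n z ⟨hz, a, ha, b, hb, h1, h2, h3, h4⟩
    refine ⟨(Finset.coe_subset.2 Finsupp.support_smul).trans hz, n • a, Λₗ.smul_mem n ha, n • b,
      Λᵣ.smul_mem n hb, ?_, ?_, ?_, ?_⟩
    · intro j hj
      simp [h1 j hj]
    · intro j hj
      simp [h2 j hj]
    · rw [← Prod.smul_mk, map_smul, h3, smul_zero]
    · rw [← Prod.smul_mk, map_smul, h4, smul_zero]

/-- The linear form comparing the entries at `x` and `y` of the left vector with those at `y₀` and
`y₁` of the right vector. -/
noncomputable def linkingForm {α : Type*} (x y y₀ y₁ : α) (s t p q : ℤ) :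
    (α →₀ ℤ) × (α →₀ ℤ) →ₗ[ℤ] ℤ :=
  LinearMap.coprod (s • Finsupp.lapply x - t • Finsupp.lapply y)
    (-(p • Finsupp.lapply y₀ + q • Finsupp.lapply y₁))

theorem linkingForm_eq_zero_iff {α : Type*} {x y y₀ y₁ : α} {s t p q : ℤ} {a b : α →₀ ℤ} :
    linkingForm x y y₀ y₁ s t p q (a, b) = 0 ↔ s * a x - t * a y = p * b y₀ + q * b y₁ := by
  simp only [linkingForm, LinearMap.coprod_apply, LinearMap.sub_apply, LinearMap.smul_apply,
    LinearMap.neg_apply, LinearMap.add_apply, Finsupp.lapply_apply, smul_eq_mul]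
  constructor <;> intro h <;> linarith

theorem Int.cast_eq_one_of_mul_self_eq_one {n : ℤ} (h : n * n = 1) : (n : ZMod 2) = 1 := by
  rcases mul_self_eq_one_iff.1 h with rfl | rfl <;> decide

/-- A cycle of a standard representation is determined by its entries at the columns. -/
theorem StandardRepr.eq_zero_of_mem_cycles {α : Type*} {S : StandardRepr α (ZMod 2)}
    {c : α →₀ ZMod 2} (hc : c ∈ S.cycles) (hY : ∀ j ∈ S.Y, c j = 0) : c = 0 := by
  ext j
  by_cases hj : j ∈ S.X
  · rw [eq_sum_of_mem_cycles hc subset_rfl hj]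
    refine Finset.sum_eq_zero fun i _ => ?_
    by_cases hi : i ∈ S.Y
    · rw [hY i hi, mul_zero]
    · rw [S.entry_of_notMem_right hi, zero_mul]
  · by_cases hj' : j ∈ S.Y
    · exact hY j hj'
    · exact notMem_support_of_notMem hc hj hj'

/-! ### The unimodular lift of a 3-sum. -/

namespace StandardRepr.IsSum3

variable {α : Type*} {S Sₗ Sᵣ : StandardRepr α (ZMod 2)} {x₀ x₁ x₂ y₀ y₁ y₂ : α}
  {D₀ : Matrix (Fin 2) (Fin 2) (ZMod 2)}

/-- This is the fundamental circuit of y₂, whose column in Sₗ has ones exactly in the rows x₁ and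
x₀. -/
theorem exists_triangle (h : S.IsSum3 Sₗ Sᵣ x₀ x₁ x₂ y₀ y₁ y₂ D₀) :
    ∃ c ∈ Sₗ.cycles, c x₁ = 1 ∧ c x₀ = 1 ∧ c y₂ = 1 ∧ ∀ j ∈ leftPart Sₗ x₀ x₁ y₂, c j = 0 := by
  classical
  have hX := h.notMem_X (Or.inl h.y₂_mem.1)
  let F : Finset α := {x₁, x₀, y₂}
  let c : α →₀ ZMod 2 := Finsupp.onFinset F (fun j => if j ∈ F then 1 else 0) (by simp)
  have hc : ∀ j, c j = if j ∈ F then 1 else 0 := fun j => rfl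
  refine ⟨c, (Sₗ.mem_cycles_iff Finsupp.support_onFinset_subset).2 ⟨?_, fun i hi => ?_⟩,
    by simp [hc, F], by simp [hc, F], by simp [hc, F], fun j hj => ?_⟩
  · refine (Finset.coe_subset.2 Finsupp.support_onFinset_subset).trans ?_
    intro j hj
    simp only [F, Finset.coe_insert, Finset.coe_singleton, mem_insert_iff, mem_singleton_iff] at hj
    rcases hj with rfl | rfl | rfl
    · exact Or.inl h.x₁_mem.1
    · exact Or.inl h.x₀_mem.1
    · exact Or.inr h.y₂_mem.1
  · rw [Finset.sum_eq_single y₂]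
    · have hiy : i ≠ y₂ := fun e => hX.1 (e ▸ hi)
      by_cases hi' : i ∈ Sₗ.X \ {x₁, x₀}
      · rw [h.left_zero i hi', zero_mul, hc, if_neg]
        have := hi'.2
        simp only [mem_insert_iff, mem_singleton_iff] at this
        simp [F, hiy, this]
      · have : i = x₁ ∨ i = x₀ := by
          by_contra hne
          exact hi' ⟨hi, by simpa using hne⟩
        rcases this with rfl | rfl
        · simp [h.left_x₁_y₂, F]
        · simp [h.left_x₀_y₂, F]
    · intro j hj hjy
      simp only [F, Finset.mem_insert, Finset.mem_singleton] at hj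
      rcases hj with rfl | rfl | rfl
      · rw [Sₗ.entry_of_notMem_right (h.notMem_Y (Or.inl h.x₁_mem.1)).1, zero_mul]
      · rw [Sₗ.entry_of_notMem_right (h.notMem_Y (Or.inl h.x₀_mem.1)).1, zero_mul]
      · exact absurd rfl hjy
    · simp [F]
  · rw [hc, if_neg]
    intro hjF
    simp only [F, Finset.mem_insert, Finset.mem_singleton] at hjF
    rcases hjF with rfl | rfl | rfl
    · simp [leftPart, (h.notMem_Y (Or.inl h.x₁_mem.1)).1] at hj
    · simp [leftPart, (h.notMem_Y (Or.inl h.x₀_mem.1)).1] at hj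
    · simp [leftPart, hX.1] at hj

/-- Row x₂ of Sᵣ has ones exactly in the columns y₀ and y₁. -/
theorem triad_even (h : S.IsSum3 Sₗ Sᵣ x₀ x₁ x₂ y₀ y₁ y₂ D₀) {c : α →₀ ZMod 2}
    (hc : c ∈ Sᵣ.cycles) : c x₂ = c y₀ + c y₁ := by
  classical
  rw [eq_sum_of_mem_cycles hc (F := c.support ∪ {y₀, y₁}) Finset.subset_union_left h.x₂_mem.2,
    ← Finset.sum_subset Finset.subset_union_right, Finset.sum_pair h.y₀_ne_y₁, h.right_x₂_y₀,
    h.right_x₂_y₁, one_mul, one_mul]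
  intro j _ hj
  by_cases hjY : j ∈ Sᵣ.Y
  · rw [h.right_zero j ⟨hjY, by simpa using hj⟩, zero_mul]
  · rw [Sᵣ.entry_of_notMem_right hjY, zero_mul]

/-- A cycle of the right summand supported on `{x₂, y₀, y₁}` vanishes. -/
theorem right_eq_zero (h : S.IsSum3 Sₗ Sᵣ x₀ x₁ x₂ y₀ y₁ y₂ D₀) {c : α →₀ ZMod 2}
    (hc : c ∈ Sᵣ.cycles) (hR : ∀ j ∈ rightPart Sᵣ x₂ y₀ y₁, c j = 0) : c = 0 := by
  classical
  have hdet := h.det_D₀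
  have hrow : ∀ i ∈ Sᵣ.X \ {x₂}, 0 = Sᵣ.entry i y₀ * c y₀ + Sᵣ.entry i y₁ * c y₁ := by
    intro i hi
    rw [← hR i (Or.inl hi),
      eq_sum_of_mem_cycles hc (F := c.support ∪ {y₀, y₁}) Finset.subset_union_left hi.1,
      ← Finset.sum_subset Finset.subset_union_right, Finset.sum_pair h.y₀_ne_y₁]
    intro j _ hj
    by_cases hjY : j ∈ Sᵣ.Y
    · rw [hR j (Or.inr ⟨hjY, by simpa using hj⟩), mul_zero]
    · rw [Sᵣ.entry_of_notMem_right hjY, zero_mul]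
  have e1 := hrow x₁ ⟨h.x₁_mem.2, h.x₁_ne_x₂⟩
  have e0 := hrow x₀ ⟨h.x₀_mem.2, h.x₀_ne_x₂⟩
  obtain ⟨r1, r2, r3, r4⟩ := h.right_entries
  rw [r1, r2] at e1
  rw [r3, r4] at e0
  have hy0 : c y₀ = 0 := by grind
  have hy1 : c y₁ = 0 := by grind
  have hx2 := h.triad_even hc
  rw [hy0, hy1, add_zero] at hx2
  ext j
  by_cases hX : j ∈ Sᵣ.X
  · by_cases hj : j = x₂
    · rw [hj, hx2, Finsupp.zero_apply]
    · exact hR j (Or.inl ⟨hX, hj⟩)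
  · by_cases hY : j ∈ Sᵣ.Y
    · by_cases hj : j = y₀ ∨ j = y₁
      · rcases hj with rfl | rfl
        · exact hy0
        · exact hy1
      · exact hR j (Or.inr ⟨hY, by simpa using hj⟩)
    · exact notMem_support_of_notMem hc hX hY

/-- Unimodular lifts of the cycle spaces of the summands yield one for the sum. -/
theorem exists_isUnimodularLift (h : S.IsSum3 Sₗ Sᵣ x₀ x₁ x₂ y₀ y₁ y₂ D₀)
    {Λₗ Λᵣ : Submodule ℤ (α →₀ ℤ)} (hl : IsUnimodularLift Λₗ Sₗ.cycles)
    (hr : IsUnimodularLift Λᵣ Sᵣ.cycles) : ∃ Λ, IsUnimodularLift Λ S.cycles := by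
  classical
  obtain ⟨γ, hγ, hγΛ⟩ := hr.exists_sign (x := x₂) (y := y₀) (y' := y₁) fun c hc => h.triad_even hc
  obtain ⟨T, hT, hT1, hT0, hT2, hTL⟩ := h.exists_triangle
  obtain ⟨τ, hτ, hτabs, rfl⟩ := hl.exists_lift T hT
  have hτne : ∀ j, modTwo τ j = 1 → τ j * τ j = 1 := by
    intro j hj
    refine Int.mul_self_eq_one_of_abs_le_one (hτabs j) fun h0 => ?_
    rw [modTwo_apply, h0] at hj
    simp at hj
  have hτ1 := hτne _ hT1
  have hτ0 := hτne _ hT0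
  have hτ2 := hτne _ hT2
  have hτL : ∀ j ∈ leftPart Sₗ x₀ x₁ y₂, τ j = 0 := fun j hj =>
    eq_zero_of_abs_le_one_of_cast_eq_zero (hτabs j) (hTL j hj)
  obtain ⟨p, q, r, s, hp, hq, hr', hs, hD⟩ := exists_triangular_lift h.det_D₀
  -- The coefficients from τ make both forms vanish on (τ, 0), the integral version of working
  -- modulo (1, 1, 1). The factor γ puts the right-hand pair in triangular form.
  refine ⟨gluedLattice Λₗ Λᵣ (leftPart Sₗ x₀ x₁ y₂) (rightPart Sᵣ x₂ y₀ y₁)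
    (linkingForm x₁ y₂ y₀ y₁ (τ x₁) (τ y₂) p (q * γ))
    (linkingForm x₀ y₂ y₀ y₁ (τ x₀) (τ y₂) r (s * γ)), ?_, ?_, ?_⟩
  · intro c hc
    obtain ⟨a, ha, b, hb, hca, hcb, h₁, h₀, ht⟩ := h.exists_compatible hc
    obtain ⟨a, haΛ, ha1, rfl⟩ := hl.exists_lift a ha
    obtain ⟨b, hbΛ, hb1, rfl⟩ := hr.exists_lift b hb
    have hqa : IsTriangular (τ x₁ * a x₁ - τ y₂ * a y₂) (τ x₀ * a x₀ - τ y₂ * a y₂) := by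
      have hza : ∀ j, modTwo a j = 0 → a j = 0 := fun j hj =>
        eq_zero_of_abs_le_one_of_cast_eq_zero (ha1 j) hj
      have hle : ∀ j, |τ j * a j| ≤ 1 := fun j => by
        rw [abs_mul]
        exact mul_le_one₀ (hτabs j) (abs_nonneg _) (ha1 j)
      have l1 := abs_le.1 (hle x₁)
      have l0 := abs_le.1 (hle x₀)
      have l2 := abs_le.1 (hle y₂)
      simp only [IsTriangular, abs_le]
      rcases ht with ⟨e2, e⟩ | ⟨e1, e0⟩
      · rw [hza _ e2, mul_zero] at *
        rcases mul_eq_zero.1 e with e | e <;> rw [hza _ e, mul_zero] at * <;> omega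
      · rw [hza _ e1, hza _ e0, mul_zero, mul_zero] at *
        omega
    -- Only the case of two nonzero entries matters: evenness then gives b x₂ = 0, and the choice of
    -- γ makes the two coordinates equal.
    have hqb : IsTriangular (b y₀) (γ * b y₁) := by
      have hle : |γ * b y₁| ≤ 1 := by
        rw [abs_mul, ← mul_one 1]
        refine mul_le_mul ?_ (hb1 y₁) (abs_nonneg _) zero_le_one
        rcases mul_self_eq_one_iff.1 hγ with rfl | rfl <;> simp
      refine ⟨hb1 y₀, hle, ?_⟩
      by_cases hb0 : b y₀ = 0
      · rw [hb0, zero_sub, abs_neg]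
        exact hle
      by_cases hb1' : b y₁ = 0
      · rw [hb1', mul_zero, sub_zero]
        exact hb1 y₀
      have hodd : ∀ j, b j ≠ 0 → modTwo b j = 1 := fun j hj =>
        ZMod.two_eq_one_of_ne_zero fun h0 =>
          hj (eq_zero_of_abs_le_one_of_cast_eq_zero (hb1 j) h0)
      have hx₂ := h.triad_even hb
      rw [hodd _ hb0, hodd _ hb1', CharTwo.add_self_eq_zero] at hx₂
      rw [hγΛ b hbΛ (eq_zero_of_abs_le_one_of_cast_eq_zero (hb1 x₂) hx₂) (hb1 _) (hb1 _) hb0 hb1',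
        ← mul_assoc, hγ, one_mul, sub_self]
      simp
    -- Both sides are triangular and congruent modulo two, hence equal up to one common sign, which
    -- is absorbed by scaling a.
    obtain ⟨ε, hε, e1, e0⟩ : ∃ ε : ℤ, |ε| = 1 ∧
        ε * (τ x₁ * a x₁ - τ y₂ * a y₂) = p * b y₀ + q * (γ * b y₁) ∧
        ε * (τ x₀ * a x₀ - τ y₂ * a y₂) = r * b y₀ + s * (γ * b y₁) := by
      have hmod : ((τ x₁ * a x₁ - τ y₂ * a y₂ : ℤ) : ZMod 2) = (p * b y₀ + q * (γ * b y₁) : ℤ) ∧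
          ((τ x₀ * a x₀ - τ y₂ * a y₂ : ℤ) : ZMod 2) = (r * b y₀ + s * (γ * b y₁) : ℤ) := by
        push_cast
        rw [hp, hq, hr', hs, Int.cast_eq_one_of_mul_self_eq_one hγ,
          Int.cast_eq_one_of_mul_self_eq_one hτ1, Int.cast_eq_one_of_mul_self_eq_one hτ0,
          Int.cast_eq_one_of_mul_self_eq_one hτ2, one_mul, one_mul, one_mul, one_mul,
          CharTwo.sub_eq_add, CharTwo.sub_eq_add]
        exact ⟨h₁, h₀⟩
      rcases hqa.eq_or_eq_neg (hD _ _ hqb) hmod.1 hmod.2 with ⟨e1, e0⟩ | ⟨e1, e0⟩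
      · exact ⟨1, by simp, by rw [e1, one_mul], by rw [e0, one_mul]⟩
      · exact ⟨-1, by simp, by rw [e1]; ring, by rw [e0]; ring⟩
    let z' : α → ℤ := fun j => if j ∈ leftPart Sₗ x₀ x₁ y₂ then ε * a j else
      if j ∈ rightPart Sᵣ x₂ y₀ y₁ then b j else 0
    let z : α →₀ ℤ := Finsupp.onFinset (a.support ∪ b.support) z' (by
      intro j hj
      simp only [z'] at hj
      rw [Finset.mem_union, Finsupp.mem_support_iff, Finsupp.mem_support_iff]
      split_ifs at hj
      · exact Or.inl (right_ne_zero_of_mul hj)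
      · exact Or.inr hj
      · exact absurd rfl hj)
    have hzL : ∀ j ∈ leftPart Sₗ x₀ x₁ y₂, z j = ε * a j := fun j hj => if_pos hj
    have hzR : ∀ j ∈ rightPart Sᵣ x₂ y₀ y₁, z j = b j := fun j hj =>
      (if_neg fun hj' => h.disjoint_parts hj' hj).trans (if_pos hj)
    have hz0 : ∀ j ∉ leftPart Sₗ x₀ x₁ y₂ ∪ rightPart Sᵣ x₂ y₀ y₁, z j = 0 := fun j hj =>
      (if_neg fun hj' => hj (Or.inl hj')).trans (if_neg fun hj' => hj (Or.inr hj'))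
    refine ⟨z, ⟨?_, ε • a, Λₗ.smul_mem ε haΛ, b, hbΛ, ?_, hzR, ?_, ?_⟩, ?_, ?_⟩
    · intro j hj
      by_contra hj'
      exact Finsupp.mem_support_iff.1 hj (hz0 j hj')
    · intro j hj
      simpa using hzL j hj
    · rw [linkingForm_eq_zero_iff]
      simp only [Finsupp.smul_apply, smul_eq_mul]
      linarith
    · rw [linkingForm_eq_zero_iff]
      simp only [Finsupp.smul_apply, smul_eq_mul]
      linarith
    · intro j
      by_cases hjL : j ∈ leftPart Sₗ x₀ x₁ y₂
      · rw [hzL j hjL, abs_mul, hε, one_mul]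
        exact ha1 j
      by_cases hjR : j ∈ rightPart Sᵣ x₂ y₀ y₁
      · rw [hzR j hjR]
        exact hb1 j
      · rw [hz0 j (by simp [hjL, hjR])]
        simp
    · ext j
      by_cases hjL : j ∈ leftPart Sₗ x₀ x₁ y₂
      · rw [modTwo_apply, hzL j hjL, hca j hjL, modTwo_apply]
        have : (ε : ZMod 2) = 1 :=
          Int.cast_eq_one_of_mul_self_eq_one (by rw [← abs_mul_abs_self, hε, one_mul])
        rw [Int.cast_mul, this, one_mul]
      by_cases hjR : j ∈ rightPart Sᵣ x₂ y₀ y₁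
      · rw [modTwo_apply, hzR j hjR, hcb j hjR, modTwo_apply]
      · have hj : j ∉ leftPart Sₗ x₀ x₁ y₂ ∪ rightPart Sᵣ x₂ y₀ y₁ := by simp [hjL, hjR]
        rw [modTwo_apply, hz0 j hj]
        rw [h.parts_union] at hj
        rw [notMem_support_of_notMem hc (fun h' => hj (Or.inl h')) fun h' => hj (Or.inr h')]
        simp
  · rintro z ⟨hz, a, ha, b, hb, hza, hzb, h₁, h₀⟩
    rw [linkingForm_eq_zero_iff] at h₁ h₀
    refine h.mem_cycles_of_compatible (hl.modTwo_mem a ha) (hr.modTwo_mem b hb)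
      ((Finset.coe_subset.2 (support_modTwo_subset z)).trans hz)
      (fun j hj => by simp [hza j hj]) (fun j hj => by simp [hzb j hj]) ?_ ?_
    · have := congrArg (Int.cast : ℤ → ZMod 2) h₁
      push_cast at this
      rwa [hp, hq, Int.cast_eq_one_of_mul_self_eq_one hγ, Int.cast_eq_one_of_mul_self_eq_one hτ1,
        Int.cast_eq_one_of_mul_self_eq_one hτ2, one_mul, one_mul, mul_one,
        CharTwo.sub_eq_add] at this
    · have := congrArg (Int.cast : ℤ → ZMod 2) h₀
      push_cast at this
      rwa [hr', hs, Int.cast_eq_one_of_mul_self_eq_one hγ, Int.cast_eq_one_of_mul_self_eq_one hτ0,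
        Int.cast_eq_one_of_mul_self_eq_one hτ2, one_mul, one_mul, mul_one,
        CharTwo.sub_eq_add] at this
  · rintro z ⟨hz, a, ha, b, hb, hza, hzb, h₁, h₀⟩
    rw [linkingForm_eq_zero_iff] at h₁ h₀
    have hz' : ((2 : ℤ) • z).support = z.support := by
      ext j
      simp
    rw [hz'] at hz
    have hb0 : modTwo b = 0 := by
      refine h.right_eq_zero (hr.modTwo_mem b hb) fun j hj => ?_
      rw [modTwo_apply, ← hzb j hj, Int.cast_zmod_two_eq_zero_iff]
      simp
    obtain ⟨b', rfl⟩ := (modTwo_eq_zero_iff b).1 hb0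
    -- Unlike b, the vector a need not be even: on the left part it is, but a multiple of the
    -- triangle may remain. Since τ y₂ squares to 1, this multiple of τ clears the entry at y₂
    -- without changing the left part or the linking forms.
    have hA : a - (τ y₂ * a y₂) • τ ∈ Λₗ := Λₗ.sub_mem ha (Λₗ.smul_mem _ hτ)
    have ha0 : modTwo (a - (τ y₂ * a y₂) • τ) = 0 := by
      refine eq_zero_of_mem_cycles (hl.modTwo_mem _ hA) fun j hj => ?_
      by_cases hjy : j ≠ y₂
      · have hjL : j ∈ leftPart Sₗ x₀ x₁ y₂ := Or.inr ⟨hj, hjy⟩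
        rw [modTwo_apply, Int.cast_zmod_two_eq_zero_iff]
        simp [hτL j hjL, ← hza j hjL]
      · rw [not_not.1 hjy, modTwo_apply]
        have : (a - (τ y₂ * a y₂) • τ) y₂ = 0 := by
          simp only [Finsupp.sub_apply, Finsupp.smul_apply, smul_eq_mul]
          linear_combination -(a y₂) * hτ2
        rw [this, Int.cast_zero]
    obtain ⟨a', ha'⟩ := (modTwo_eq_zero_iff _).1 ha0
    have haj : ∀ j, a j - τ y₂ * a y₂ * τ j = 2 * a' j := fun j => by
      simpa using DFunLike.congr_fun ha' j
    refine ⟨hz, a', hl.half_mem a' (ha' ▸ hA), b', hr.half_mem b' hb, fun j hj => ?_,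
      fun j hj => ?_, ?_, ?_⟩
    · have e1 := hza j hj
      have e2 := haj j
      simp only [Finsupp.smul_apply, smul_eq_mul] at e1
      rw [hτL j hj] at e2
      linarith
    · have e1 := hzb j hj
      simp only [Finsupp.smul_apply, smul_eq_mul] at e1
      linarith
    · rw [linkingForm_eq_zero_iff]
      simp only [Finsupp.smul_apply, smul_eq_mul] at h₁
      refine mul_left_cancel₀ (two_ne_zero (α := ℤ)) ?_
      linear_combination h₁ - τ x₁ * haj x₁ + τ y₂ * haj y₂ - τ y₂ * a y₂ * hτ1 + τ y₂ * a y₂ * hτ2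
    · rw [linkingForm_eq_zero_iff]
      simp only [Finsupp.smul_apply, smul_eq_mul] at h₀
      refine mul_left_cancel₀ (two_ne_zero (α := ℤ)) ?_
      linear_combination h₀ - τ x₀ * haj x₀ + τ y₂ * haj y₂ - τ y₂ * a y₂ * hτ0 + τ y₂ * a y₂ * hτ2

end StandardRepr.IsSum3

theorem mainTheorem2 {α : Type*} (M Mₗ Mᵣ : Matroid α) (hM : M.IsSum3of Mₗ Mᵣ)
    (hMₗ : Mₗ.IsRegular) (hMᵣ : Mᵣ.IsRegular) : M.IsRegular := by
  obtain ⟨S, Sₗ, Sᵣ, ⟨x₀, x₁, x₂, y₀, y₁, y₂, D₀, h⟩, rfl, rfl, rfl⟩ := hM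
  obtain ⟨Λₗ, Cₗ, hCₗ, hl⟩ := hMₗ.exists_isUnimodularLift
  obtain ⟨Λᵣ, Cᵣ, hCᵣ, hr⟩ := hMᵣ.exists_isUnimodularLift
  -- Uniqueness transfers the lift from the space supplied by regularity to the cycle space of the
  -- given standard representation.
  rw [hCₗ.unique Sₗ.toMatroid_isRepresentedBy] at hl
  rw [hCᵣ.unique Sᵣ.toMatroid_isRepresentedBy] at hr
  obtain ⟨Λ, hΛ⟩ := h.exists_isUnimodularLift hl hr
  exact S.toMatroid_isRepresentedBy.isRegular hΛ
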